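/- Let $I$ be a finite set. A \emph{forest} on $I$ is a finite set of rooted binary trees (non-planar, up to isomorphism) whose leaves are bijectively labeled by $I$; a forest with one component is a \emph{tree}. Let $V(F)$ denote the set of inner (trivalent) vertices of a forest $F$, with edges oriented towards the roots. For forests $F,F'$ on $I$, write $F\le F'$ if there is a topological map from $F$ to $F'$ that is increasing with respect to the orientation towards the root, maps inner vertices to inner vertices injectively, is the identity of $I$ on leaves, and is injective on each tree of $F$. This is a partial order on the set $\operatorname{For}(I)$ of forests on $I$, the images of the inner vertices are determined by $F$ and $F'$, and the intervals of $\operatorname{For}(I)$ are ranked. For a finite ranked poset $P$ with minimum $\widehat 0$, maximum $\widehat 1$, rank function $\operatorname{rk}$ and Möbius function $\mu$, put $\operatorname{crk}(a)=\operatorname{rk}(\widehat 1)-\operatorname{rk}(a)$, $\deg(P)=\operatorname{crk}(\widehat 0)$, $\chi(P)(y)=\sum_{b\in P}\mu(\widehat 0,b)\,y^{\operatorname{crk}(b)}\in\mathbb Z[y]$ and $\mu(P)=\mu(\widehat 0,\widehat 1)$. Let $T$ be a tree on $I$ having at least one inner vertex, let $I=I_1\sqcup I_2$ be the partition of the labels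 given by the two subtrees $T_1$ (on $I_1$) and $T_2$ (on $I_2$) grafted on the lowest inner vertex of $T$, and let $F\le T$ be a forest such that the image of $V(F)$ in $V(T)$ does not contain the lowest inner vertex of $T$ (the interval $[F,T]$ is then called \emph{special}). Then $F$ is the disjoint union of a forest $F_1$ on $I_1$ and a forest $F_2$ on $I_2$, and $F_1\le T_1$, $F_2\le T_2$. Let $\chi,\chi_1,\chi_2$ and $\mu,\mu_1,\mu_2$ be the characteristic polynomials and Möbius numbers of the intervals $[F,T]$, $[F_1,T_1]$, $[F_2,T_2]$, and let $\deg_i=\deg([F_i,T_i])$ for $i=1,2$. Then the polynomial $\chi$ depends only on the polynomials $\chi_1$ and $\chi_2$, and $$\chi(y)=\bigl(y-(\deg_1+1)(\deg_2+1)\bigr)\,\chi_1(y)\,\chi_2(y).$$ In particular, $$\mu=-(\deg_1+1)(\deg_2+1)\,\mu_1\,\mu_2 .$$ -/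

import Mathlib

open Polynomial

/-!
Leaf-labeled rooted binary forests, the poset of such forests, and the invariants of its intervals.
-/

/-- A forest of leaf-labeled rooted binary trees on the finite label set `I`, up to isomorphism
fixing the labels. A vertex (inner vertex or leaf) is recorded as the set of labels of its ancestor
leaves, so the leaf labeled `i` is `{i}`, and `A ⊆ B` says that the path from `A` to the root goes
through `B`. Roots are left out: each maximal vertex has one root edge below it. -/
@[ext]
structure LForest {α : Type*} [DecidableEq α] (I : Finset α) where
  /-- the inner vertices and the leaves -/
  verts : Finset (Finset α)
  subset_labels : ∀ A ∈ verts, A ⊆ I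
  nonempty : ∀ A ∈ verts, A.Nonempty
  leaf_mem : ∀ i ∈ I, {i} ∈ verts
  /-- two vertices are comparable or have no ancestor leaf in common -/
  laminar : ∀ A ∈ verts, ∀ B ∈ verts, A ⊆ B ∨ B ⊆ A ∨ Disjoint A B
  /-- each vertex other than a leaf has two edges coming in -/
  binary : ∀ A ∈ verts, 1 < A.card → ∃ B ∈ verts, ∃ C ∈ verts, Disjoint B C ∧ B ∪ C = A

namespace LForest

variable {α : Type*} [DecidableEq α] {I : Finset α}

/-- The set `V(F)` of inner vertices. -/
def inner (F : LForest I) : Finset (Finset α) := F.verts.filter fun A => 1 < A.card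

/-- Being a tree: all leaves have a common lowest vertex. -/
def IsTree (F : LForest I) : Prop := I ∈ F.verts

/-- `f` gives the images of the vertices under a topological map from `F` to `F'` of the kind that
defines the order on forests; the edge of `F` from `A` towards the root is mapped onto the path in
`F'` from `f A` to the image of the next vertex (a root edge, onto a part of the edge
below the image of its vertex). -/
structure IsTopMap (F F' : LForest I) (f : Finset α → Finset α) : Prop where
  mem : ∀ A ∈ F.verts, f A ∈ F'.verts
  /-- increasing for the orientation towards the root -/
  mono : ∀ A ∈ F.verts, ∀ B ∈ F.verts, A ⊆ B → f A ⊆ f B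
  /-- inner vertices are mapped to inner vertices -/
  inner_mem : ∀ A ∈ F.inner, f A ∈ F'.inner
  /-- injectively -/
  inner_inj : ∀ A ∈ F.inner, ∀ B ∈ F.inner, f A = f B → A = B
  /-- the identity on leaves -/
  leaf : ∀ i ∈ I, f {i} = {i}
  /-- injective on each tree: if `B` and `C` are the two vertices just above the inner vertex `A`,
  then the paths from `f B` and from `f C` to `f A` do not meet before `f A` -/
  branch : ∀ A ∈ F.verts, ∀ B ∈ F.verts, ∀ C ∈ F.verts, Disjoint B C → B ∪ C = A →
    ∀ Z ∈ F'.verts, f B ⊆ Z → f C ⊆ Z → f A ⊆ Z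

/-- `F ≤ F'` if there is a topological map from `F` to `F'` as above. -/
instance : LE (LForest I) := ⟨fun F F' => ∃ f, IsTopMap F F' f⟩

theorem le_def {F F' : LForest I} : F ≤ F' ↔ ∃ f, IsTopMap F F' f := Iff.rfl

theorem mem_inner {F : LForest I} {A : Finset α} : A ∈ F.inner ↔ A ∈ F.verts ∧ 1 < A.card := by
  simp [inner]

theorem eq_singleton {F : LForest I} {A : Finset α} (hA : A ∈ F.verts) (h : ¬ 1 < A.card) :
    ∃ i ∈ I, A = {i} := by
  have h1 : A.card = 1 := by
    have := (F.nonempty A hA).card_pos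
    omega
  obtain ⟨i, rfl⟩ := Finset.card_eq_one.1 h1
  exact ⟨i, F.subset_labels _ hA (by simp), rfl⟩

theorem IsTopMap.subset {F F' : LForest I} {f : Finset α → Finset α} (h : IsTopMap F F' f)
    {A : Finset α} (hA : A ∈ F.verts) : A ⊆ f A := by
  intro i hi
  have hI := F.subset_labels A hA hi
  have := h.mono _ (F.leaf_mem i hI) A hA (by simpa using hi)
  rw [h.leaf i hI] at this
  simpa using this

/-- `f A` is the smallest vertex of `F'` below all the leaves in `A`. -/
theorem IsTopMap.least {F F' : LForest I} {f : Finset α → Finset α} (h : IsTopMap F F' f)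
    {Z : Finset α} (hZ : Z ∈ F'.verts) : ∀ A ∈ F.verts, A ⊆ Z → f A ⊆ Z := by
  intro A
  induction A using Finset.strongInduction with
  | H A ih =>
    intro hA hAZ
    by_cases hc : 1 < A.card
    · obtain ⟨B, hB, C, hC, hd, rfl⟩ := F.binary A hA hc
      have hBC : B ⊂ B ∪ C := by
        refine Finset.ssubset_iff_subset_ne.2 ⟨Finset.subset_union_left, fun e => ?_⟩
        obtain ⟨x, hx⟩ := F.nonempty C hC
        exact Finset.disjoint_left.1 hd (by rw [e]; simp [hx]) hx
      have hCB : C ⊂ B ∪ C := by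
        refine Finset.ssubset_iff_subset_ne.2 ⟨Finset.subset_union_right, fun e => ?_⟩
        obtain ⟨x, hx⟩ := F.nonempty B hB
        exact Finset.disjoint_left.1 hd hx (by rw [e]; simp [hx])
      exact h.branch _ hA B hB C hC hd rfl Z hZ (ih B hBC hB (hBC.subset.trans hAZ))
        (ih C hCB hC (hCB.subset.trans hAZ))
    · obtain ⟨i, hi, rfl⟩ := eq_singleton hA hc
      rwa [h.leaf i hi]

theorem IsTopMap.of_least {F F' : LForest I} {f : Finset α → Finset α}
    (mem : ∀ A ∈ F.verts, f A ∈ F'.verts)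
    (mono : ∀ A ∈ F.verts, ∀ B ∈ F.verts, A ⊆ B → f A ⊆ f B)
    (inner_mem : ∀ A ∈ F.inner, f A ∈ F'.inner)
    (inner_inj : ∀ A ∈ F.inner, ∀ B ∈ F.inner, f A = f B → A = B)
    (leaf : ∀ i ∈ I, f {i} = {i}) (sub : ∀ A ∈ F.verts, A ⊆ f A)
    (least : ∀ A ∈ F.verts, ∀ Z ∈ F'.verts, A ⊆ Z → f A ⊆ Z) : IsTopMap F F' f where
  mem := mem
  mono := mono
  inner_mem := inner_mem
  inner_inj := inner_inj
  leaf := leaf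
  branch := by
    intro A hA B hB C hC _ hU Z hZ hBZ hCZ
    refine least A hA Z hZ ?_
    rw [← hU]
    exact Finset.union_subset ((sub B hB).trans hBZ) ((sub C hC).trans hCZ)

theorem IsTopMap.id (F : LForest I) : IsTopMap F F fun A => A where
  mem _ h := h
  mono _ _ _ _ h := h
  inner_mem _ h := h
  inner_inj _ _ _ _ h := h
  leaf _ _ := rfl
  branch := by
    rintro _ _ B _ C _ _ rfl Z _ hB hC
    exact Finset.union_subset hB hC

/-- A map as above separates the two branches at an inner vertex. -/
theorem IsTopMap.not_subset {F F' : LForest I} {f : Finset α → Finset α} (h : IsTopMap F F' f)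
    {A B C : Finset α} (hA : A ∈ F.inner) (hB : B ∈ F.verts) (hC : C ∈ F.verts)
    (hd : Disjoint B C) (hU : B ∪ C = A) : ¬ f B ⊆ f C := by
  intro hs
  have hAv := (mem_inner.1 hA).1
  have h1 : f A ⊆ f C := h.branch A hAv B hB C hC hd hU _ (h.mem C hC) hs subset_rfl
  have h2 : f C ⊆ f A := h.mono C hC A hAv (hU ▸ Finset.subset_union_right)
  have e := h1.antisymm h2
  by_cases hc : 1 < C.card
  · have := h.inner_inj A hA C (mem_inner.2 ⟨hC, hc⟩) e
    obtain ⟨x, hx⟩ := F.nonempty B hB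
    refine Finset.disjoint_left.1 hd hx ?_
    rw [← this, ← hU]
    simp [hx]
  · obtain ⟨i, hi, rfl⟩ := eq_singleton hC hc
    have := (mem_inner.1 (h.inner_mem A hA)).2
    rw [e, h.leaf i hi] at this
    simp at this

theorem IsTopMap.comp {F G H : LForest I} {f g : Finset α → Finset α} (hf : IsTopMap F G f)
    (hg : IsTopMap G H g) : IsTopMap F H fun A => g (f A) := by
  refine IsTopMap.of_least (fun A hA => hg.mem _ (hf.mem A hA))
    (fun A hA B hB h => hg.mono _ (hf.mem A hA) _ (hf.mem B hB) (hf.mono A hA B hB h))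
    (fun A hA => hg.inner_mem _ (hf.inner_mem A hA))
    (fun A hA B hB e => hf.inner_inj A hA B hB
      (hg.inner_inj _ (hf.inner_mem A hA) _ (hf.inner_mem B hB) e))
    (fun i hi => by simp only [hf.leaf i hi, hg.leaf i hi])
    (fun A hA => (hf.subset hA).trans (hg.subset (hf.mem A hA))) ?_
  intro A hA Z hZ hAZ
  by_cases hc : 1 < A.card
  · have hfA := hf.inner_mem A (mem_inner.2 ⟨hA, hc⟩)
    obtain ⟨hfv, hfc⟩ := mem_inner.1 hfA
    obtain ⟨D, hD, E, hE, hd, hU⟩ := G.binary _ hfv hfc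
    have hDE := hg.not_subset hfA hD hE hd hU
    have hED := hg.not_subset hfA hE hD hd.symm (by rw [Finset.union_comm, hU])
    have hgd : Disjoint (g D) (g E) := by
      rcases H.laminar _ (hg.mem D hD) _ (hg.mem E hE) with h | h | h
      · exact absurd h hDE
      · exact absurd h hED
      · exact h
    have hsub : A ⊆ D ∪ E := hU ▸ hf.subset hA
    -- `A` is contained neither in `D` nor in `E`
    have key : ∀ D E : Finset α, D ∈ G.verts → E ∈ G.verts → Disjoint D E → D ∪ E = f A →
        ∃ x ∈ A, x ∈ D := by
      intro D E hD hE hd hU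
      by_contra hno
      push Not at hno
      have : f A ⊆ E := hf.least hE A hA fun x hx => by
        have hx' : x ∈ D ∪ E := hU ▸ hf.subset hA hx
        rcases Finset.mem_union.1 hx' with h | h
        · exact absurd h (hno x hx)
        · exact h
      obtain ⟨y, hy⟩ := G.nonempty D hD
      exact Finset.disjoint_left.1 hd hy (this (hU ▸ Finset.mem_union_left _ hy))
    obtain ⟨x, hxA, hxD⟩ := key D E hD hE hd hU
    obtain ⟨y, hyA, hyE⟩ := key E D hE hD hd.symm (by rw [Finset.union_comm, hU])
    have hxg := hg.subset hD hxD
    have hyg := hg.subset hE hyE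
    have h1 : g D ⊆ Z := by
      rcases H.laminar _ (hg.mem D hD) _ hZ with h | h | h
      · exact h
      · exact absurd hyg (Finset.disjoint_left.1 hgd (h (hAZ hyA)))
      · exact absurd (hAZ hxA) (Finset.disjoint_left.1 h hxg)
    have h2 : g E ⊆ Z := by
      rcases H.laminar _ (hg.mem E hE) _ hZ with h | h | h
      · exact h
      · exact absurd (h (hAZ hxA)) (Finset.disjoint_left.1 hgd hxg)
      · exact absurd (hAZ hyA) (Finset.disjoint_left.1 h hyg)
    exact hg.branch _ hfv D hD E hE hd hU Z hZ h1 h2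
  · obtain ⟨i, hi, rfl⟩ := eq_singleton hA hc
    simpa only [hf.leaf i hi, hg.leaf i hi] using hAZ

/-- A map as above from a forest to itself fixes every vertex. -/
theorem IsTopMap.eq_self {F : LForest I} {f : Finset α → Finset α} (h : IsTopMap F F f)
    {A : Finset α} (hA : A ∈ F.verts) : f A = A :=
  (h.least hA A hA subset_rfl).antisymm (h.subset hA)

theorem verts_subset_of_le_of_le {F G : LForest I} (h₁ : F ≤ G) (h₂ : G ≤ F) :
    F.verts ⊆ G.verts := by
  obtain ⟨f, hf⟩ := h₁
  obtain ⟨g, hg⟩ := h₂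
  intro A hA
  have h1 : g (f A) = A := (hf.comp hg).eq_self hA
  have h2 : f A ⊆ A := by
    conv_rhs => rw [← h1]
    exact hg.subset (hf.mem A hA)
  rw [(hf.subset hA).antisymm h2]
  exact hf.mem A hA

/-- The poset `For(I)`. -/
instance : PartialOrder (LForest I) where
  le_refl F := ⟨_, IsTopMap.id F⟩
  le_trans _ _ _ := fun ⟨_, hf⟩ ⟨_, hg⟩ => ⟨_, hf.comp hg⟩
  le_antisymm _ _ h₁ h₂ := LForest.ext
    ((verts_subset_of_le_of_le h₁ h₂).antisymm (verts_subset_of_le_of_le h₂ h₁))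

instance : Finite (LForest I) := by
  refine Finite.of_injective
    (fun F : LForest I => (⟨F.verts, ?_⟩ : {S // S ∈ I.powerset.powerset})) ?_
  · rw [Finset.mem_powerset]
    exact fun A hA => Finset.mem_powerset.2 (F.subset_labels A hA)
  · intro F G h
    exact LForest.ext (congrArg Subtype.val h)

/-- The forest `F[J]` on `J` made of the vertices of `F` all of whose ancestor leaves are in `J`. If
`F` is the disjoint union of a forest on `J` and a forest on the rest of the labels, this is the
first of the two. If `J` is a vertex of `F`, this is the subtree with lowest vertex `J`. -/
def restrict (F : LForest I) {J : Finset α} (hJ : J ⊆ I) : LForest J where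
  verts := F.verts.filter fun A => A ⊆ J
  subset_labels A hA := (Finset.mem_filter.1 hA).2
  nonempty A hA := F.nonempty A (Finset.mem_filter.1 hA).1
  leaf_mem i hi := Finset.mem_filter.2 ⟨F.leaf_mem i (hJ hi), by simpa using hi⟩
  laminar A hA B hB := F.laminar A (Finset.mem_filter.1 hA).1 B (Finset.mem_filter.1 hB).1
  binary A hA hc := by
    obtain ⟨hA, hs⟩ := Finset.mem_filter.1 hA
    obtain ⟨B, hB, C, hC, hd, rfl⟩ := F.binary A hA hc
    exact ⟨B, Finset.mem_filter.2 ⟨hB, Finset.subset_union_left.trans hs⟩, C,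
      Finset.mem_filter.2 ⟨hC, Finset.subset_union_right.trans hs⟩, hd, rfl⟩

/-- `[F, T]` is a special interval: `T` is a tree that has a lowest inner vertex (namely `I`),
`F ≤ T`, and the image of `V(F)` in `V(T)` does not contain the lowest inner vertex of `T`. -/
def IsSpecial (F T : LForest I) : Prop :=
  T.IsTree ∧ I ∈ T.inner ∧ ∃ f, IsTopMap F T f ∧ ∀ A ∈ F.inner, f A ≠ I

/-- `I = I₁ ⊔ I₂` is the partition of the labels defined by the lowest inner vertex of `T`. -/
def IsSplit (T : LForest I) (I₁ I₂ : Finset α) : Prop :=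
  I₁ ∈ T.verts ∧ I₂ ∈ T.verts ∧ Disjoint I₁ I₂ ∧ I₁ ∪ I₂ = I

end LForest

noncomputable section

/-! ### Invariants of finite posets with a minimum and a maximum -/

/-- The rank of `a`: the length of the longest chains with top element `a` (in a ranked poset, of
all maximal chains with top element `a`). -/
def posetRank {P : Type*} [Preorder P] (a : P) : ℕ := (Order.height a).toNat

/-- The corank `crk(a) = rk(1) - rk(a)`. -/
def posetCorank {P : Type*} [Preorder P] [BoundedOrder P] (a : P) : ℕ :=
  posetRank (⊤ : P) - posetRank a

/-- The degree `deg(P) = crk(0)`. -/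
def posetDeg (P : Type*) [Preorder P] [BoundedOrder P] : ℕ := posetCorank (⊥ : P)

open Classical in
/-- The Möbius function of a finite poset. -/
def posetMu {P : Type*} [PartialOrder P] [Finite P] (a b : P) : ℤ :=
  letI := Fintype.ofFinite P
  letI : LocallyFiniteOrder P := Fintype.toLocallyFiniteOrder
  IncidenceAlgebra.mu ℤ a b

/-- The Möbius number `μ(P) = μ(0, 1)`. -/
def moebiusNumber (P : Type*) [PartialOrder P] [BoundedOrder P] [Finite P] : ℤ :=
  posetMu (⊥ : P) ⊤

/-- The characteristic polynomial `χ(P) = ∑_b μ(0, b) y ^ crk(b)`. -/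
def charPoly (P : Type*) [PartialOrder P] [BoundedOrder P] [Finite P] : ℤ[X] :=
  letI := Fintype.ofFinite P
  ∑ b : P, C (posetMu ⊥ b) * X ^ posetCorank b

/-! ### The same for the interval `[F, F']` of a finite poset -/

/-- The degree of the interval `[F, F']`. -/
def intervalDeg {Q : Type*} [PartialOrder Q] {F F' : Q} (h : F ≤ F') : ℕ :=
  haveI : Fact (F ≤ F') := ⟨h⟩
  posetDeg (Set.Icc F F')

/-- The Möbius number of the interval `[F, F']`. -/
def intervalMoebius {Q : Type*} [PartialOrder Q] [Finite Q] {F F' : Q} (h : F ≤ F') : ℤ :=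
  haveI : Fact (F ≤ F') := ⟨h⟩
  moebiusNumber (Set.Icc F F')

/-- The characteristic polynomial of the interval `[F, F']`. -/
def intervalCharPoly {Q : Type*} [PartialOrder Q] [Finite Q] {F F' : Q} (h : F ≤ F') : ℤ[X] :=
  haveI : Fact (F ≤ F') := ⟨h⟩
  charPoly (Set.Icc F F')

end

namespace LForest

variable {α : Type*} [DecidableEq α] {I : Finset α}

theorem IsSpecial.le {F T : LForest I} (h : IsSpecial F T) : F ≤ T :=
  let ⟨f, hf, _⟩ := h.2.2
  ⟨f, hf⟩

theorem IsSplit.left {T : LForest I} {I₁ I₂ : Finset α} (h : T.IsSplit I₁ I₂) : I₁ ⊆ I :=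
  T.subset_labels _ h.1

theorem IsSplit.right {T : LForest I} {I₁ I₂ : Finset α} (h : T.IsSplit I₁ I₂) : I₂ ⊆ I :=
  T.subset_labels _ h.2.1

end LForest

/-! Write `P = [F, T]`, `P₁ = [F₁, T₁]`, `P₂ = [F₂, T₂]`, and let `p : P → P₁ × P₂` restrict a
forest to the two sides. A vertex of some `G ≤ T` with leaves on both sides must go to the lowest
vertex of `T`, so by injectivity `G` has at most one such crossing vertex. Hence `G` is either the
disjoint union of its restrictions, or that union with one tree of each side grafted together.

This presents `P` as a union of sections of `p`: the disjoint union `s`, and for each pair `m = (B,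
C)` of a root of `F₁` and a root of `F₂` the section `j m`, which grafts the tree containing `B` and
the tree containing `C`. Different `j m` may share values, but the `j m ⊥` are pairwise distinct. An
element `x` lies above `s q` exactly when `q ≤ p x`, and above `j m q` exactly when moreover `x` is
in the image of `j m`. With `ν` the Möbius function of the product from its minimum, it follows that
`μ(⊥, x)` is `ν (p x)` times the indicator of the image of `s`, minus `ν (p x)` times the number of
`m` for which `x` is in the image of `j m`. Coranks in `P` exceed those in the product by one on `s`
and agree on `j m`, so the characteristic polynomial is `(y - |M|) χ₁ χ₂`, where `M` is the set of
pairs `m` (`charPoly_eq_of_cover`).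

Two facts about forests remain. Intervals are ranked by the number of inner vertices
(`exists_card_inner_add_one`). The numbers of roots and of inner vertices add up to the number of
labels (`card_roots_add_card_inner`), so `Fᵢ`, lying under a tree, has `degᵢ + 1` roots, and `|M| =
(deg₁ + 1)(deg₂ + 1)`. Finally `degᵢ` is the degree of `χᵢ`, and Möbius numbers are values at `0`.
-/

/-! ### Ranks, Möbius functions and characteristic polynomials of finite posets -/

section Poset

variable {P : Type*} [PartialOrder P] [BoundedOrder P]

/-- A strictly monotone function bounds the height from above, and descending to `⊥` in steps of one
bounds it from below. In particular the height is finite, so `toNat` loses nothing. -/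
theorem posetRank_eq_of_strictMono (r : P → ℕ) (hr : StrictMono r)
    (hc : ∀ a : P, a ≠ ⊥ → ∃ c < a, r c + 1 = r a) (a : P) : posetRank a = r a - r ⊥ := by
  have hbot : ∀ a, r ⊥ ≤ r a := fun a => hr.monotone bot_le
  have key : Order.height a = ((r a - r ⊥ : ℕ) : ℕ∞) := by
    refine le_antisymm ?_ ?_
    · have hf : StrictMono fun a => r a - r ⊥ := fun a b h => by
        have := hr h
        have := hbot a
        simp only
        omega
      simpa using Order.height_le_height_apply_of_strictMono _ hf a
    · induction h : r a using Nat.strong_induction_on generalizing a with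
      | _ n ih =>
        by_cases ha : a = ⊥
        · simp [← h, ha]
        · obtain ⟨c, hca, hc'⟩ := hc a ha
          have h1 := ih (r c) (by omega) c rfl
          have h2 := Order.height_add_one_le hca
          refine le_trans ?_ h2
          refine le_trans ?_ (add_le_add_left h1 1)
          have := hbot c
          have e : n - r ⊥ = (r c - r ⊥) + 1 := by omega
          rw [e]
          push_cast
          exact le_rfl
  rw [posetRank, key]
  rfl

theorem posetCorank_eq_of_strictMono (r : P → ℕ) (hr : StrictMono r)
    (hc : ∀ a : P, a ≠ ⊥ → ∃ c < a, r c + 1 = r a) (a : P) : posetCorank a = r ⊤ - r a := by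
  have h1 : r ⊥ ≤ r a := hr.monotone bot_le
  have h2 : r a ≤ r ⊤ := hr.monotone le_top
  rw [posetCorank, posetRank_eq_of_strictMono r hr hc, posetRank_eq_of_strictMono r hr hc]
  omega

variable [Fintype P]

theorem sum_posetMu_bot (x : P) [DecidablePred (· ≤ x)] [Decidable (x = ⊥)] :
    ∑ y with y ≤ x, posetMu (⊥ : P) y = if x = ⊥ then 1 else 0 := by
  classical
  let _ : LocallyFiniteOrder P := (letI := Fintype.ofFinite P; Fintype.toLocallyFiniteOrder)
  have h := IncidenceAlgebra.sum_Icc_mu_right (𝕜 := ℤ) (⊥ : P) x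
  simp only [eq_comm (a := x)]
  convert h using 2
  · ext y
    simp
  · unfold posetMu
    congr!

/-- The recursion determines the values by induction on `x`, so a guessed formula for the Möbius
function needs only this check. -/
theorem posetMu_bot_unique [DecidableLE P] [DecidableEq P] (f : P → ℤ)
    (hf : ∀ x, ∑ y with y ≤ x, f y = if x = ⊥ then 1 else 0) (x : P) :
    posetMu (⊥ : P) x = f x := by
  induction x using WellFoundedLT.induction with
  | _ x ih =>
    have h := (sum_posetMu_bot x).trans (hf x).symm
    have hx : x ∈ Finset.univ.filter (· ≤ x) := by simp
    rw [← Finset.add_sum_erase _ _ hx, ← Finset.add_sum_erase _ f hx] at h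
    rw [Finset.sum_congr rfl fun y hy => ih y ?_] at h
    · linarith
    · simp only [Finset.mem_erase, Finset.mem_filter, Finset.mem_univ, true_and] at hy
      exact lt_of_le_of_ne hy.2 hy.1

theorem charPoly_eq_sum : charPoly P = ∑ b : P, C (posetMu ⊥ b) * X ^ posetCorank b := by
  unfold charPoly
  congr!

theorem posetMu_self : posetMu (⊥ : P) ⊥ = 1 := by
  classical
  have := sum_posetMu_bot (⊥ : P)
  simpa [le_bot_iff, Finset.sum_filter] using this

theorem charPoly_eval_zero (h : ∀ a : P, posetCorank a = 0 → a = ⊤) :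
    (charPoly P).eval 0 = moebiusNumber P := by
  classical
  rw [charPoly_eq_sum, eval_finsetSum, Finset.sum_eq_single ⊤]
  · simp [posetCorank, moebiusNumber]
  · intro b _ hb
    have : posetCorank b ≠ 0 := fun e => hb (h b e)
    simp [this]
  · simp

/-- The leading term comes from `⊥` alone, with coefficient `μ(⊥, ⊥) = 1`. This makes the degree of
a poset readable from its characteristic polynomial. -/
theorem charPoly_natDegree (h : ∀ a : P, a ≠ ⊥ → posetCorank a < posetDeg P) :
    (charPoly P).natDegree = posetDeg P := by
  classical
  refine natDegree_eq_of_le_of_coeff_ne_zero ?_ ?_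
  · rw [charPoly_eq_sum]
    refine natDegree_sum_le_of_forall_le _ _ fun b _ => (natDegree_C_mul_X_pow_le _ _).trans ?_
    by_cases hb : b = ⊥
    · rw [hb, posetDeg]
    · exact (h b hb).le
  · rw [charPoly_eq_sum, finsetSum_coeff, Finset.sum_eq_single ⊥]
    · simp [posetDeg, posetMu_self]
    · intro b _ hb
      rw [coeff_C_mul_X_pow, if_neg (h b hb).ne']
    · simp

end Poset

/-- The characteristic polynomial of a poset `P` made of a copy `s` of a product `P₁ × P₂` and of
further copies `j m` that may overlap with each other. -/
theorem charPoly_eq_of_cover {P P₁ P₂ M : Type*} [PartialOrder P] [BoundedOrder P] [Finite P]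
    [PartialOrder P₁] [BoundedOrder P₁] [Finite P₁] [PartialOrder P₂] [BoundedOrder P₂] [Finite P₂]
    [Fintype M] (p : P → P₁ × P₂) (s : P₁ × P₂ → P) (j : M → P₁ × P₂ → P)
    (hps : ∀ q, p (s q) = q) (hpj : ∀ m q, p (j m q) = q)
    (hs : ∀ q x, s q ≤ x ↔ q ≤ p x) (hj : ∀ m q x, j m q ≤ x ↔ q ≤ p x ∧ x = j m (p x))
    (hcov : ∀ x, x = s (p x) ∨ ∃ m, x = j m (p x)) (hsj : ∀ m q, s q ≠ j m q)
    (hinj : ∀ m m', j m ⊥ = j m' ⊥ → m = m')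
    (hcs : ∀ q, posetCorank (s q) = posetCorank q.1 + posetCorank q.2 + 1)
    (hcj : ∀ m q, posetCorank (j m q) = posetCorank q.1 + posetCorank q.2) :
    charPoly P = (X - C (Fintype.card M : ℤ)) * charPoly P₁ * charPoly P₂ := by
  classical
  let _ := Fintype.ofFinite P
  let _ := Fintype.ofFinite P₁
  let _ := Fintype.ofFinite P₂
  set ν : P₁ × P₂ → ℤ := fun q => posetMu ⊥ q.1 * posetMu ⊥ q.2 with hν
  have hνsum : ∀ q, ∑ r with r ≤ q, ν r = if q = ⊥ then 1 else 0 := by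
    intro q
    have e : (Finset.univ.filter (· ≤ q)) =
        (Finset.univ.filter (· ≤ q.1)) ×ˢ (Finset.univ.filter (· ≤ q.2)) := by
      ext r
      simp [Prod.le_def]
    rw [e, Finset.sum_product, ← Finset.sum_mul_sum, sum_posetMu_bot, sum_posetMu_bot]
    have : q = ⊥ ↔ q.1 = ⊥ ∧ q.2 = ⊥ := Prod.ext_iff
    simp only [this, ite_and, mul_ite, mul_one, mul_zero]
    split_ifs <;> rfl
  -- sums over the image of a section
  have hsec : ∀ (A : Type _) [AddCommMonoid A] (t : P₁ × P₂ → P) (_ : ∀ q, p (t q) = q)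
      (S : Finset P) (g : P → A),
      ∑ x ∈ S, (if x = t (p x) then g x else 0) = ∑ q with t q ∈ S, g (t q) := by
    intro A _ t ht S g
    rw [← Finset.sum_filter]
    refine Finset.sum_bij' (fun x _ => p x) (fun q _ => t q) ?_ ?_ ?_ ?_ ?_
    · intro x hx
      obtain ⟨hx, e⟩ := Finset.mem_filter.1 hx
      simpa [← e] using hx
    · intro q hq
      simpa [ht] using hq
    · intro x hx
      exact (Finset.mem_filter.1 hx).2.symm
    · intro q _
      exact ht q
    · intro x hx
      rw [← (Finset.mem_filter.1 hx).2]
  have hsecν (t : P₁ × P₂ → P) (ht : ∀ q, p (t q) = q) (S : Finset P) :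
      ∑ x ∈ S, (if x = t (p x) then ν (p x) else 0) = ∑ q with t q ∈ S, ν q := by
    simpa only [ht] using hsec _ t ht S fun x => ν (p x)
  have hsecX (t : P₁ × P₂ → P) (ht : ∀ q, p (t q) = q) :
      ∑ x, (if x = t (p x) then C (ν (p x)) * X ^ posetCorank x else 0) =
        ∑ q, C (ν q) * X ^ posetCorank (t q) := by
    simpa only [ht, Finset.mem_univ, Finset.filter_true] using
      hsec _ t ht Finset.univ fun x => C (ν (p x)) * X ^ posetCorank x
  have hbot : (⊥ : P) = s ⊥ := le_antisymm bot_le ((hs _ _).2 bot_le)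
  -- By `hs` and `hj`, each sum over `y ≤ x` becomes a sum of `ν` over `q ≤ p x`, present for `j m`
  -- only if `x` is in its image. Such a sum is the indicator of `p x = ⊥`.
  have hmu : ∀ x, posetMu (⊥ : P) x = (if x = s (p x) then ν (p x) else 0) -
      ∑ m, if x = j m (p x) then ν (p x) else 0 := by
    refine posetMu_bot_unique _ fun x => ?_
    rw [Finset.sum_sub_distrib, Finset.sum_comm]
    simp only [hsecν s hps, hsecν (j _) (hpj _), Finset.mem_filter, Finset.mem_univ,
      true_and, hs, hj]
    rw [hνsum]
    have : ∀ m, (∑ q with q ≤ p x ∧ x = j m (p x), ν q) =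
        if p x = ⊥ ∧ x = j m (p x) then 1 else 0 := by
      intro m
      by_cases h : x = j m (p x)
      · simp only [← h, and_true, hνsum]
      · simp [h]
    simp only [this]
    -- The elements over the minimum of the product are `s ⊥ = ⊥`, with total `1 - 0`, and the
    -- pairwise distinct `j m ⊥`, with total `1 - 1`.
    by_cases hx : p x = ⊥
    · simp only [hx, if_true, true_and]
      rcases hcov x with h | ⟨m, h⟩
      · rw [hx] at h
        rw [Finset.sum_eq_zero, hbot, if_pos h, sub_zero]
        intro m _
        rw [if_neg]
        rw [h]
        exact hsj m ⊥
      · rw [hx] at h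
        rw [Finset.sum_eq_single m, if_pos h, sub_self, if_neg]
        · rw [hbot, h]
          exact (hsj m ⊥).symm
        · intro m' _ hm'
          rw [if_neg]
          exact fun e => hm' (hinj _ _ (e.symm.trans h))
        · simp
    · have : x ≠ ⊥ := by
        rintro rfl
        rw [hbot, hps] at hx
        exact hx rfl
      simp [hx, this]
  have hprod : charPoly P₁ * charPoly P₂ =
      ∑ q : P₁ × P₂, C (ν q) * X ^ (posetCorank q.1 + posetCorank q.2) := by
    rw [charPoly_eq_sum, charPoly_eq_sum, Finset.sum_mul_sum, ← Finset.sum_product',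
      Finset.univ_product_univ]
    refine Finset.sum_congr rfl fun q _ => ?_
    simp only [hν, C_mul, pow_add]
    ring
  have hterm : ∀ x : P, C (posetMu ⊥ x) * X ^ posetCorank x =
      (if x = s (p x) then C (ν (p x)) * X ^ posetCorank x else 0) -
      ∑ m, if x = j m (p x) then C (ν (p x)) * X ^ posetCorank x else 0 := by
    intro x
    rw [hmu, C_sub, sub_mul, map_sum, Finset.sum_mul]
    congr 1
    · split_ifs <;> simp
    · refine Finset.sum_congr rfl fun m _ => ?_
      split_ifs <;> simp
  rw [charPoly_eq_sum, mul_assoc, hprod, Finset.sum_congr rfl fun x _ => hterm x,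
    Finset.sum_sub_distrib, Finset.sum_comm]
  simp only [hsecX s hps, hsecX (j _) (hpj _), hcs, hcj]
  rw [sub_mul, Finset.sum_const, Finset.card_univ, nsmul_eq_mul, Finset.mul_sum _ _ X]
  refine congrArg₂ _ (Finset.sum_congr rfl fun q _ => by ring) ?_
  simp

/-! ### Lowest vertices, roots, removing and adding the lowest vertex of a tree -/

namespace LForest

variable {α : Type*} [DecidableEq α] {I : Finset α} {F G H : LForest I}

/-- `Z` is the smallest vertex of `G` below all the leaves in `A`. -/
def IsLca (G : LForest I) (A Z : Finset α) : Prop :=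
  Z ∈ G.verts ∧ A ⊆ Z ∧ ∀ W ∈ G.verts, A ⊆ W → Z ⊆ W

theorem IsLca.unique {A Z Z' : Finset α} (h : G.IsLca A Z) (h' : G.IsLca A Z') : Z = Z' :=
  (h.2.2 _ h'.1 h'.2.1).antisymm (h'.2.2 _ h.1 h.2.1)

theorem isLca_self {A : Finset α} (hA : A ∈ G.verts) : G.IsLca A A :=
  ⟨hA, subset_rfl, fun _ _ h => h⟩

theorem laminar_of_mem {A B : Finset α} (hA : A ∈ G.verts) (hB : B ∈ G.verts) {x : α}
    (hxA : x ∈ A) (hxB : x ∈ B) : A ⊆ B ∨ B ⊆ A := by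
  rcases G.laminar A hA B hB with h | h | h
  · exact Or.inl h
  · exact Or.inr h
  · exact absurd hxB (Finset.disjoint_left.1 h hxA)

theorem exists_isLca {A W : Finset α} (hA : A.Nonempty) (hW : W ∈ G.verts) (h : A ⊆ W) :
    ∃ Z, G.IsLca A Z := by
  obtain ⟨x, hx⟩ := hA
  obtain ⟨Z, hZ⟩ := (G.verts.filter (A ⊆ ·)).exists_minimal ⟨W, by simp [hW, h]⟩
  obtain ⟨hZv, hAZ⟩ := Finset.mem_filter.1 hZ.1
  refine ⟨Z, hZv, hAZ, fun V hV hAV => ?_⟩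
  rcases laminar_of_mem hZv hV (hAZ hx) (hAV hx) with h' | h'
  · exact h'
  · exact hZ.2 (Finset.mem_filter.2 ⟨hV, hAV⟩) h'

theorem IsTopMap.isLca {f : Finset α → Finset α} (h : IsTopMap F G f) {A : Finset α}
    (hA : A ∈ F.verts) : G.IsLca A (f A) :=
  ⟨h.mem A hA, h.subset hA, fun _ hW hAW => h.least hW A hA hAW⟩

theorem exists_isLca_of_le (h : F ≤ G) {A : Finset α} (hA : A ∈ F.verts) : ∃ Z, G.IsLca A Z :=
  let ⟨_, hf⟩ := h
  ⟨_, hf.isLca hA⟩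

theorem IsLca.trans (h : F ≤ G) (h' : G ≤ H) {A Z W : Finset α} (hA : A ∈ F.verts)
    (hZ : G.IsLca A Z) (hW : H.IsLca Z W) : H.IsLca A W := by
  obtain ⟨f, hf⟩ := h
  obtain ⟨g, hg⟩ := h'
  have e : g (f A) = W := by
    rw [(hf.isLca hA).unique hZ]
    exact (hg.isLca hZ.1).unique hW
  exact e ▸ (hf.comp hg).isLca hA

/-- The map is forced: a vertex goes to the smallest vertex of `G` containing it. What can fail is
the existence of that vertex and injectivity on inner vertices; the other conditions on the map are
automatic. -/
theorem le_iff : F ≤ G ↔ (∀ A ∈ F.verts, ∃ Z ∈ G.verts, A ⊆ Z) ∧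
    ∀ A ∈ F.inner, ∀ B ∈ F.inner, ∀ Z, G.IsLca A Z → G.IsLca B Z → A = B := by
  constructor
  · rintro ⟨f, hf⟩
    refine ⟨fun A hA => ⟨f A, hf.mem A hA, hf.subset hA⟩, fun A hA B hB Z hAZ hBZ => ?_⟩
    refine hf.inner_inj A hA B hB ?_
    rw [(hf.isLca (mem_inner.1 hA).1).unique hAZ, (hf.isLca (mem_inner.1 hB).1).unique hBZ]
  · rintro ⟨h1, h2⟩
    have h3 : ∀ A, ∃ Z, A ∈ F.verts → G.IsLca A Z := by
      intro A
      by_cases hA : A ∈ F.verts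
      · obtain ⟨W, hW, hAW⟩ := h1 A hA
        obtain ⟨Z, hZ⟩ := exists_isLca (F.nonempty A hA) hW hAW
        exact ⟨Z, fun _ => hZ⟩
      · exact ⟨A, fun h => absurd h hA⟩
    choose f hf using h3
    refine ⟨f, IsTopMap.of_least (fun A hA => (hf A hA).1) ?_ ?_ ?_ ?_ (fun A hA => (hf A hA).2.1)
      fun A hA => (hf A hA).2.2⟩
    · intro A hA B hB hAB
      exact (hf A hA).2.2 _ (hf B hB).1 (hAB.trans (hf B hB).2.1)
    · intro A hA
      obtain ⟨hA, hc⟩ := mem_inner.1 hA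
      exact mem_inner.2 ⟨(hf A hA).1, hc.trans_le (Finset.card_le_card (hf A hA).2.1)⟩
    · intro A hA B hB e
      exact h2 A hA B hB _ (hf A (mem_inner.1 hA).1) (e ▸ hf B (mem_inner.1 hB).1)
    · intro i hi
      exact (hf _ (F.leaf_mem i hi)).unique (isLca_self (G.leaf_mem i hi))

theorem le_of_subset (h : F.verts ⊆ G.verts) : F ≤ G :=
  le_iff.2 ⟨fun A hA => ⟨A, h hA, subset_rfl⟩, fun _ hA _ hB _ hAZ hBZ =>
    (isLca_self (h (mem_inner.1 hA).1)).unique hAZ |>.trans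
      (hBZ.unique (isLca_self (h (mem_inner.1 hB).1)))⟩

theorem inner_of_isLca {A Z : Finset α} (hA : A ∈ F.verts) (h : G.IsLca A Z) (hZ : 1 < Z.card) :
    A ∈ F.inner := by
  refine mem_inner.2 ⟨hA, ?_⟩
  by_contra hc
  obtain ⟨i, hi, rfl⟩ := eq_singleton hA hc
  rw [← (isLca_self (G.leaf_mem i hi)).unique h] at hZ
  simp at hZ

/-- The lowest vertices of the trees of a forest. -/
def roots (G : LForest I) : Finset (Finset α) :=
  G.verts.filter fun A => ∀ B ∈ G.verts, A ⊆ B → B = A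

theorem mem_roots {R : Finset α} :
    R ∈ G.roots ↔ R ∈ G.verts ∧ ∀ B ∈ G.verts, R ⊆ B → B = R := by
  simp [roots]

theorem exists_root {A : Finset α} (hA : A ∈ G.verts) : ∃ R ∈ G.roots, A ⊆ R := by
  obtain ⟨R, hAR, hR⟩ := G.verts.exists_le_maximal hA
  exact ⟨R, mem_roots.2 ⟨hR.1, fun B hB h => (hR.2 hB h).antisymm h⟩, hAR⟩

theorem subset_root {R W : Finset α} (hR : R ∈ G.roots) (hW : W ∈ G.verts) {x : α} (hxR : x ∈ R)
    (hxW : x ∈ W) : W ⊆ R := by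
  obtain ⟨hR, hm⟩ := mem_roots.1 hR
  rcases laminar_of_mem hW hR hxW hxR with h | h
  · exact h
  · exact (hm W hW h).subset

theorem root_unique {R R' : Finset α} (hR : R ∈ G.roots) (hR' : R' ∈ G.roots) {x : α} (hx : x ∈ R)
    (hx' : x ∈ R') : R = R' :=
  (subset_root hR' (mem_roots.1 hR).1 hx' hx).antisymm (subset_root hR (mem_roots.1 hR').1 hx hx')

theorem roots_disjoint {R R' : Finset α} (hR : R ∈ G.roots) (hR' : R' ∈ G.roots) (h : R ≠ R') :
    Disjoint R R' :=
  Finset.disjoint_left.2 fun _ hx hx' => h (root_unique hR hR' hx hx')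

theorem subset_root_of_le (h : F ≤ G) {A R : Finset α} (hA : A ∈ F.verts) (hR : R ∈ G.roots)
    {x : α} (hxA : x ∈ A) (hxR : x ∈ R) : A ⊆ R := by
  obtain ⟨Z, hZ⟩ := exists_isLca_of_le h hA
  exact hZ.2.1.trans (subset_root hR hZ.1 hxR (hZ.2.1 hxA))

/-- A vertex above `B ∪ C` is above one of the two branches. -/
theorem subset_branch {B C W : Finset α} (hB : B ∈ G.verts) (hC : C ∈ G.verts)
    (hW : W ∈ G.verts) (h : W ⊆ B ∪ C) (hne : W ≠ B ∪ C) : W ⊆ B ∨ W ⊆ C := by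
  by_contra hno
  push Not at hno
  obtain ⟨h1, h2⟩ := hno
  obtain ⟨x, hx, hxB⟩ := Finset.not_subset.1 h1
  obtain ⟨y, hy, hyC⟩ := Finset.not_subset.1 h2
  have hxC : x ∈ C := (Finset.mem_union.1 (h hx)).resolve_left hxB
  have hyB : y ∈ B := (Finset.mem_union.1 (h hy)).resolve_right hyC
  refine hne (h.antisymm (Finset.union_subset ?_ ?_))
  · exact (laminar_of_mem hW hB hy hyB).resolve_left h1
  · exact (laminar_of_mem hW hC hx hxC).resolve_left h2

theorem one_lt_card_union {B C : Finset α} (hB : B.Nonempty) (hC : C.Nonempty)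
    (hd : Disjoint B C) : 1 < (B ∪ C).card := by
  rw [Finset.card_union_of_disjoint hd]
  have := hB.card_pos
  have := hC.card_pos
  omega

theorem union_notMem_verts {B C : Finset α} (hB : B ∈ G.roots) (hC : C.Nonempty)
    (hd : Disjoint B C) : B ∪ C ∉ G.verts := by
  intro h
  have e := (mem_roots.1 hB).2 _ h Finset.subset_union_left
  obtain ⟨x, hx⟩ := hC
  exact Finset.disjoint_right.1 hd hx (e ▸ Finset.mem_union_right _ hx)

/-- Two trees of a forest can be grafted on a new vertex. -/
theorem exists_graft {B C : Finset α} (hB : B ∈ G.roots) (hC : C ∈ G.roots) (hne : B ≠ C) :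
    ∃ G' : LForest I, G'.verts = insert (B ∪ C) G.verts := by
  have hBv := (mem_roots.1 hB).1
  have hCv := (mem_roots.1 hC).1
  have hlam : ∀ W ∈ G.verts, W ⊆ B ∪ C ∨ Disjoint W (B ∪ C) := by
    intro W hW
    by_cases h : Disjoint W (B ∪ C)
    · exact Or.inr h
    · obtain ⟨x, hxW, hx⟩ := Finset.not_disjoint_iff.1 h
      rcases Finset.mem_union.1 hx with hx | hx
      · exact Or.inl ((subset_root hB hW hx hxW).trans Finset.subset_union_left)
      · exact Or.inl ((subset_root hC hW hx hxW).trans Finset.subset_union_right)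
  refine ⟨⟨insert (B ∪ C) G.verts, ?_, ?_, ?_, ?_, ?_⟩, rfl⟩
  · intro A hA
    rcases Finset.mem_insert.1 hA with rfl | hA
    · exact Finset.union_subset (G.subset_labels B hBv) (G.subset_labels C hCv)
    · exact G.subset_labels A hA
  · intro A hA
    rcases Finset.mem_insert.1 hA with rfl | hA
    · exact (G.nonempty B hBv).mono Finset.subset_union_left
    · exact G.nonempty A hA
  · exact fun i hi => Finset.mem_insert_of_mem (G.leaf_mem i hi)
  · intro A hA A' hA'
    rcases Finset.mem_insert.1 hA with rfl | hA <;> rcases Finset.mem_insert.1 hA' with rfl | hA'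
    · exact Or.inl subset_rfl
    · rcases hlam A' hA' with h | h
      · exact Or.inr (Or.inl h)
      · exact Or.inr (Or.inr h.symm)
    · rcases hlam A hA with h | h
      · exact Or.inl h
      · exact Or.inr (Or.inr h)
    · exact G.laminar A hA A' hA'
  · intro A hA hc
    rcases Finset.mem_insert.1 hA with rfl | hA
    · exact ⟨B, Finset.mem_insert_of_mem hBv, C, Finset.mem_insert_of_mem hCv,
        roots_disjoint hB hC hne, rfl⟩
    · obtain ⟨D, hD, E, hE, h⟩ := G.binary A hA hc
      exact ⟨D, Finset.mem_insert_of_mem hD, E, Finset.mem_insert_of_mem hE, h⟩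

/-- The lowest inner vertex of a tree of a forest can be removed. -/
theorem exists_erase {R : Finset α} (hR : R ∈ G.roots) (hc : 1 < R.card) :
    ∃ (G' : LForest I) (B C : Finset α), B ∈ G'.roots ∧ C ∈ G'.roots ∧ Disjoint B C ∧ B ∪ C = R ∧
      R ∉ G'.verts ∧ G.verts = insert R G'.verts ∧
      G'.roots = insert B (insert C (G.roots.erase R)) := by
  obtain ⟨hRv, hRm⟩ := mem_roots.1 hR
  obtain ⟨B, hB, C, hC, hd, hU⟩ := G.binary R hRv hc
  have hBne : B ≠ R := by
    rintro rfl
    obtain ⟨x, hx⟩ := G.nonempty C hC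
    exact Finset.disjoint_right.1 hd hx (by rw [← hU]; simp [hx])
  have hCne : C ≠ R := by
    rintro rfl
    obtain ⟨x, hx⟩ := G.nonempty B hB
    exact Finset.disjoint_left.1 hd hx (by rw [← hU]; simp [hx])
  let G' : LForest I :=
    { verts := G.verts.erase R
      subset_labels := fun A hA => G.subset_labels A (Finset.mem_of_mem_erase hA)
      nonempty := fun A hA => G.nonempty A (Finset.mem_of_mem_erase hA)
      leaf_mem := fun i hi => Finset.mem_erase.2 ⟨fun e => by simp [← e] at hc, G.leaf_mem i hi⟩
      laminar := fun A hA A' hA' =>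
        G.laminar A (Finset.mem_of_mem_erase hA) A' (Finset.mem_of_mem_erase hA')
      binary := fun A hA h => by
        obtain ⟨hne, hAG⟩ := Finset.mem_erase.1 hA
        obtain ⟨D, hD, E, hE, hDE, rfl⟩ := G.binary A hAG h
        refine ⟨D, Finset.mem_erase.2 ⟨?_, hD⟩, E, Finset.mem_erase.2 ⟨?_, hE⟩, hDE, rfl⟩
        · rintro rfl
          exact hne (hRm _ hAG Finset.subset_union_left)
        · rintro rfl
          exact hne (hRm _ hAG Finset.subset_union_right) }
  have hmem : ∀ A, A ∈ G'.verts ↔ A ≠ R ∧ A ∈ G.verts := fun A => Finset.mem_erase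
  have hchild : ∀ A ∈ G'.verts, ∀ x ∈ R, x ∈ A → A ⊆ B ∨ A ⊆ C := by
    intro A hA x hxR hxA
    obtain ⟨hne, hA⟩ := (hmem A).1 hA
    have := subset_root hR hA hxR hxA
    rw [← hU] at this hne
    exact subset_branch hB hC hA this hne
  have hBr : B ∈ G'.roots := by
    refine mem_roots.2 ⟨(hmem B).2 ⟨hBne, hB⟩, fun A hA hBA => ?_⟩
    obtain ⟨x, hx⟩ := G.nonempty B hB
    rcases hchild A hA x (by simp [← hU, hx]) (hBA hx) with h | h
    · exact h.antisymm hBA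
    · exact absurd (h (hBA hx)) (Finset.disjoint_left.1 hd hx)
  have hCr : C ∈ G'.roots := by
    refine mem_roots.2 ⟨(hmem C).2 ⟨hCne, hC⟩, fun A hA hCA => ?_⟩
    obtain ⟨x, hx⟩ := G.nonempty C hC
    rcases hchild A hA x (by simp [← hU, hx]) (hCA hx) with h | h
    · exact absurd (h (hCA hx)) (Finset.disjoint_right.1 hd hx)
    · exact h.antisymm hCA
  refine ⟨G', B, C, hBr, hCr, hd, hU, fun h => ((hmem R).1 h).1 rfl,
    (Finset.insert_erase hRv).symm, ?_⟩
  ext A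
  simp only [Finset.mem_insert, Finset.mem_erase]
  constructor
  · intro hA
    obtain ⟨hAv, hAm⟩ := mem_roots.1 hA
    obtain ⟨hne, hAG⟩ := (hmem A).1 hAv
    by_cases h : ∃ x ∈ R, x ∈ A
    · obtain ⟨x, hxR, hxA⟩ := h
      rcases hchild A hAv x hxR hxA with h | h
      · exact Or.inl (hAm B (mem_roots.1 hBr).1 h).symm
      · exact Or.inr (Or.inl (hAm C (mem_roots.1 hCr).1 h).symm)
    · refine Or.inr (Or.inr ⟨hne, mem_roots.2 ⟨hAG, fun W hW hAW => ?_⟩⟩)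
      refine hAm W ((hmem W).2 ⟨?_, hW⟩) hAW
      rintro rfl
      obtain ⟨x, hx⟩ := G.nonempty A hAG
      exact h ⟨x, hAW hx, hx⟩
  · rintro (rfl | rfl | ⟨hne, hA⟩)
    · exact hBr
    · exact hCr
    · obtain ⟨hA, hAm⟩ := mem_roots.1 hA
      exact mem_roots.2 ⟨(hmem A).2 ⟨hne, hA⟩, fun W hW => hAm W ((hmem W).1 hW).2⟩

/-! ### Counting trees and inner vertices; comparing forests after removing or grafting lowest
vertices -/

theorem card_inner_of_insert {R : Finset α} {G' : LForest I} (h : G.verts = insert R G'.verts)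
    (hR : R ∉ G'.verts) (hc : 1 < R.card) : G.inner.card = G'.inner.card + 1 := by
  rw [inner, h, Finset.filter_insert, if_pos hc, Finset.card_insert_of_notMem]
  · rfl
  · exact fun h => hR (Finset.mem_filter.1 h).1

theorem verts_eq_of_inner_eq_empty (h : G.inner = ∅) : G.verts = I.image fun i => {i} := by
  ext A
  simp only [Finset.mem_image]
  constructor
  · intro hA
    obtain ⟨i, hi, rfl⟩ := eq_singleton hA fun hc => by
      have : A ∈ G.inner := mem_inner.2 ⟨hA, hc⟩
      simp [h] at this
    exact ⟨i, hi, rfl⟩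
  · rintro ⟨i, hi, rfl⟩
    exact G.leaf_mem i hi

theorem exists_inner_root (h : G.inner.Nonempty) : ∃ R ∈ G.roots, 1 < R.card := by
  obtain ⟨A, hA⟩ := h
  obtain ⟨hA, hc⟩ := mem_inner.1 hA
  obtain ⟨R, hR, hAR⟩ := exists_root hA
  exact ⟨R, hR, hc.trans_le (Finset.card_le_card hAR)⟩

/-- Removing the lowest inner vertex of a tree splits the tree in two: one inner vertex less, one
root more. Without inner vertices every label is a root. -/
theorem card_roots_add_card_inner (G : LForest I) : G.roots.card + G.inner.card = I.card := by
  induction h : G.inner.card generalizing G with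
  | zero =>
    have hv := verts_eq_of_inner_eq_empty (Finset.card_eq_zero.1 h)
    have : G.roots = G.verts := by
      refine Finset.filter_true_of_mem fun A hA B hB hAB => ?_
      rw [hv] at hA hB
      obtain ⟨i, _, rfl⟩ := Finset.mem_image.1 hA
      obtain ⟨k, _, rfl⟩ := Finset.mem_image.1 hB
      rw [Finset.singleton_subset_singleton.1 hAB]
    rw [this, hv, Finset.card_image_of_injective _ Finset.singleton_injective]
    rfl
  | succ n ih =>
    obtain ⟨R, hR, hc⟩ := exists_inner_root (Finset.card_pos.1 (by omega : 0 < G.inner.card))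
    obtain ⟨G', B, C, hB, hC, hd, hU, hRG, hv, hr⟩ := exists_erase hR hc
    have h1 := card_inner_of_insert hv hRG hc
    have h2 := ih G' (by omega)
    have hBne := G'.nonempty B (mem_roots.1 hB).1
    have hBC : B ≠ C := by
      rintro rfl
      exact hBne.ne_empty (Finset.disjoint_self_iff_empty _ |>.1 hd)
    have hnot : ∀ D, D ∈ G'.verts → D ⊆ R → D ∉ G.roots.erase R := by
      intro D hD hDR h
      obtain ⟨hne, hD'⟩ := Finset.mem_erase.1 h
      exact hne ((mem_roots.1 hD').2 R (mem_roots.1 hR).1 hDR).symm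
    rw [hr, Finset.card_insert_of_notMem, Finset.card_insert_of_notMem
      (hnot C (mem_roots.1 hC).1 (hU ▸ Finset.subset_union_right)),
      Finset.card_erase_of_mem hR] at h2
    · have := Finset.card_pos.2 ⟨R, hR⟩
      omega
    · rw [Finset.mem_insert, not_or]
      exact ⟨hBC, hnot B (mem_roots.1 hB).1 (hU ▸ Finset.subset_union_left)⟩

/-- As `R` contains every vertex of `G` that it meets, dropping it from `G` does not change the
smallest vertex containing `A` unless that vertex was `R`. -/
theorem le_of_insert_right {R : Finset α} {F' G' : LForest I} (h : F ≤ G)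
    (hv : G.verts = insert R G'.verts) (hR : R ∈ G.roots) (hF : F'.verts ⊆ F.verts)
    (hn : ∀ A ∈ F'.verts, ¬ G.IsLca A R) : F' ≤ G' := by
  refine le_iff.2 ⟨fun A hA => ?_, fun A hA B hB Z hAZ hBZ => ?_⟩
  · obtain ⟨Z, hZ⟩ := exists_isLca_of_le h (hF hA)
    refine ⟨Z, ?_, hZ.2.1⟩
    have := hZ.1
    rw [hv] at this
    exact (Finset.mem_insert.1 this).resolve_left fun e => hn A hA (e ▸ hZ)
  · have key : ∀ A ∈ F'.verts, G'.IsLca A Z → G.IsLca A Z := by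
      rintro A hA ⟨hZ, hAZ, hmin⟩
      have hZG : Z ∈ G.verts := hv ▸ Finset.mem_insert_of_mem hZ
      refine ⟨hZG, hAZ, fun W hW hAW => ?_⟩
      rw [hv] at hW
      rcases Finset.mem_insert.1 hW with rfl | hW
      · obtain ⟨x, hx⟩ := F'.nonempty A hA
        exact subset_root hR hZG (hAW hx) (hAZ hx)
      · exact hmin W hW hAW
    obtain ⟨hA, hAc⟩ := mem_inner.1 hA
    obtain ⟨hB, hBc⟩ := mem_inner.1 hB
    exact (le_iff.1 h).2 A (mem_inner.2 ⟨hF hA, hAc⟩) B (mem_inner.2 ⟨hF hB, hBc⟩) Z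
      (key A hA hAZ) (key B hB hBZ)

/-- No vertex of `G` contains `B ∪ C`: meeting the root `B'`, it would lie in `B'` and miss `C'`. So
the new vertex can only go to the new vertex, while the old ones keep their images. -/
theorem le_of_insert {B C B' C' : Finset α} {F' G' : LForest I} (h : F ≤ G)
    (hF : F'.verts = insert (B ∪ C) F.verts) (hG : G'.verts = insert (B' ∪ C') G.verts)
    (hB' : B' ∈ G.roots) (hd : Disjoint B' C') (hB : B.Nonempty)
    (hC : C.Nonempty) (hBB : B ⊆ B') (hCC : C ⊆ C') : F' ≤ G' := by
  have hnot := union_notMem_verts hB' (hC.mono hCC) hd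
  have key : ∀ A ∈ F.verts, ∀ Z, G'.IsLca A Z → G.IsLca A Z := by
    rintro A hA Z ⟨hZ, hAZ, hmin⟩
    have hmin' : ∀ W ∈ G.verts, A ⊆ W → Z ⊆ W :=
      fun W hW => hmin W (hG ▸ Finset.mem_insert_of_mem hW)
    refine ⟨?_, hAZ, hmin'⟩
    rw [hG] at hZ
    rcases Finset.mem_insert.1 hZ with rfl | hZ
    · obtain ⟨W, hW, hAW⟩ := (le_iff.1 h).1 A hA
      have h1 := hmin' W hW hAW
      have e := (mem_roots.1 hB').2 W hW (Finset.subset_union_left.trans h1)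
      obtain ⟨x, hx⟩ := hC
      exact absurd (hCC hx)
        (Finset.disjoint_left.1 hd (e ▸ h1 (Finset.mem_union_right _ (hCC hx))))
    · exact hZ
  have key' : ∀ Z, G'.IsLca (B ∪ C) Z → Z ∉ G.verts := by
    rintro Z ⟨hZ, hsub, hmin⟩ hZG
    have h1 : Z ⊆ B' ∪ C' := hmin _ (hG ▸ Finset.mem_insert_self _ _)
      (Finset.union_subset_union hBB hCC)
    obtain ⟨x, hx⟩ := hB
    obtain ⟨y, hy⟩ := hC
    have h2 := subset_root hB' hZG (hBB hx) (hsub (Finset.mem_union_left _ hx))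
    exact Finset.disjoint_right.1 hd (hCC hy) (h2 (hsub (Finset.mem_union_right _ hy)))
  refine le_iff.2 ⟨fun A hA => ?_, fun A hA D hD Z hAZ hDZ => ?_⟩
  · rw [hF] at hA
    rw [hG]
    rcases Finset.mem_insert.1 hA with rfl | hA
    · exact ⟨_, Finset.mem_insert_self _ _, Finset.union_subset_union hBB hCC⟩
    · obtain ⟨Z, hZ, hAZ⟩ := (le_iff.1 h).1 A hA
      exact ⟨Z, Finset.mem_insert_of_mem hZ, hAZ⟩
  · obtain ⟨hA, hAc⟩ := mem_inner.1 hA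
    obtain ⟨hD, hDc⟩ := mem_inner.1 hD
    rw [hF] at hA hD
    rcases Finset.mem_insert.1 hA with rfl | hA <;> rcases Finset.mem_insert.1 hD with rfl | hD
    · rfl
    · exact absurd (key D hD Z hDZ).1 (key' Z hAZ)
    · exact absurd (key A hA Z hAZ).1 (key' Z hDZ)
    · exact (le_iff.1 h).2 A (mem_inner.2 ⟨hA, hAc⟩) D (mem_inner.2 ⟨hD, hDc⟩) Z (key A hA Z hAZ)
        (key D hD Z hDZ)

/-- Below `G` and above `F` there is a forest with one inner vertex less than `G`. -/
theorem exists_card_inner_add_one (h : F < G) :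
    ∃ H : LForest I, F ≤ H ∧ H ≤ G ∧ H.inner.card + 1 = G.inner.card := by
  -- Remove the lowest inner vertex `R` of a tree of `G`. If no vertex of `F` goes to `R`, what is
  -- left of `G` is the required forest. Otherwise remove also the vertex `A` of `F` that goes to
  -- `R`, apply induction to the remaining forests, and graft the trees of the resulting forest that
  -- contain the two branches of `A`.
  induction hn : G.inner.card generalizing F G with
  | zero =>
    refine absurd (le_of_subset ?_) h.not_ge
    rw [verts_eq_of_inner_eq_empty (Finset.card_eq_zero.1 hn)]
    intro A hA
    obtain ⟨i, hi, rfl⟩ := Finset.mem_image.1 hA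
    exact F.leaf_mem i hi
  | succ n ih =>
    obtain ⟨R, hR, hc⟩ := exists_inner_root (Finset.card_pos.1 (by omega : 0 < G.inner.card))
    obtain ⟨G', D, E, hD, hE, hDE, hU, hRG, hv, -⟩ := exists_erase hR hc
    have hcard := card_inner_of_insert hv hRG hc
    by_cases hA : ∃ A ∈ F.verts, G.IsLca A R
    swap
    · push Not at hA
      refine ⟨G', le_of_insert_right h.le hv hR subset_rfl hA, le_of_subset ?_, by omega⟩
      exact hv ▸ Finset.subset_insert _ _
    obtain ⟨A, hA, hAR⟩ := hA
    have hAin := inner_of_isLca hA hAR hc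
    -- A vertex of `F` containing `A` also goes to `R`, as `R` is maximal in `G`; injectivity makes
    -- it equal to `A`.
    have hAroot : A ∈ F.roots := by
      refine mem_roots.2 ⟨hA, fun W hW hAW => ?_⟩
      obtain ⟨Z, hZ⟩ := exists_isLca_of_le h.le hW
      have e := (mem_roots.1 hR).2 Z hZ.1 (hAR.2.2 Z hZ.1 (hAW.trans hZ.2.1))
      rw [e] at hZ
      exact (le_iff.1 h.le).2 W (inner_of_isLca hW hZ hc) A hAin R hZ hAR
    obtain ⟨F', B, C, hB, hC, hBC, hU', hAF, hv', -⟩ := exists_erase hAroot (mem_inner.1 hAin).2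
    have hF'F : F'.verts ⊆ F.verts := hv' ▸ Finset.subset_insert _ _
    have hle : F' ≤ G' := by
      refine le_of_insert_right h.le hv hR hF'F fun X hX hXR => ?_
      have := (le_iff.1 h.le).2 X (inner_of_isLca (hF'F hX) hXR hc) A hAin R hXR hAR
      exact hAF (this ▸ hX)
    have hside : ∀ X ∈ F'.verts, X ⊆ A → X ⊆ D ∨ X ⊆ E := by
      intro X hX hXA
      obtain ⟨x, hx⟩ := F'.nonempty X hX
      have := hAR.2.1 (hXA hx)
      rw [← hU] at this
      rcases Finset.mem_union.1 this with hx' | hx'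
      · exact Or.inl (subset_root_of_le hle hX hD hx hx')
      · exact Or.inr (subset_root_of_le hle hX hE hx hx')
    have hBv := (mem_roots.1 hB).1
    have hCv := (mem_roots.1 hC).1
    have hnotsub : ∀ X ∈ G'.verts, X ⊆ R → ¬ A ⊆ X := by
      intro X hX hXR hAX
      refine hRG ((hXR.antisymm (hAR.2.2 X ?_ hAX)) ▸ hX)
      exact hv ▸ Finset.mem_insert_of_mem hX
    -- the conclusion, once it is known which branch goes where
    have main : ∀ D E, D ∈ G'.roots → E ∈ G'.roots → Disjoint D E → D ∪ E = R → B ⊆ D → C ⊆ E →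
        ∃ H : LForest I, F ≤ H ∧ H ≤ G ∧ H.inner.card + 1 = n + 1 := by
      intro D E hD hE hDE hU hBD hCE
      -- If the two were equal, the roots `B ⊆ D` and `C ⊆ E` would coincide, and adding back the
      -- removed vertices would give `F = G`.
      have hlt : F' < G' := by
        refine lt_of_le_of_ne hle ?_
        rintro rfl
        have hBD' := (mem_roots.1 hB).2 D (mem_roots.1 hD).1 hBD
        have hCE' := (mem_roots.1 hC).2 E (mem_roots.1 hE).1 hCE
        refine h.ne (LForest.ext ?_)
        rw [hv, hv', ← hU, ← hU', hBD', hCE']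
      obtain ⟨H', hFH, hHG, hH'⟩ := ih hlt (by omega)
      have hup : ∀ X ∈ F'.verts, ∃ X' ∈ H'.roots, X ⊆ X' := by
        intro X hX
        obtain ⟨Z, hZ⟩ := exists_isLca_of_le hFH hX
        obtain ⟨X', hX', hs⟩ := exists_root hZ.1
        exact ⟨X', hX', hZ.2.1.trans hs⟩
      obtain ⟨B', hB', hBB⟩ := hup B hBv
      obtain ⟨C', hC', hCC⟩ := hup C hCv
      have hBne := F'.nonempty B hBv
      have hCne := F'.nonempty C hCv
      have hB'D : B' ⊆ D := by
        obtain ⟨x, hx⟩ := hBne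
        exact subset_root_of_le hHG (mem_roots.1 hB').1 hD (hBB hx) (hBD hx)
      have hC'E : C' ⊆ E := by
        obtain ⟨x, hx⟩ := hCne
        exact subset_root_of_le hHG (mem_roots.1 hC').1 hE (hCC hx) (hCE hx)
      have hd : Disjoint B' C' := Finset.disjoint_of_subset_left hB'D
        (Finset.disjoint_of_subset_right hC'E hDE)
      have hne : B' ≠ C' := by
        rintro rfl
        exact (hBne.mono hBB).ne_empty (Finset.disjoint_self_iff_empty _ |>.1 hd)
      obtain ⟨H, hH⟩ := exists_graft hB' hC' hne
      refine ⟨H, ?_, ?_, ?_⟩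
      · exact le_of_insert hFH (by rw [hv', hU']) hH hB' hd hBne hCne hBB hCC
      · exact le_of_insert hHG hH (by rw [hv, hU]) hD hDE (hBne.mono hBB) (hCne.mono hCC)
          hB'D hC'E
      · rw [card_inner_of_insert hH (union_notMem_verts hB' (hCne.mono hCC) hd)
          (one_lt_card_union (hBne.mono hBB) (hCne.mono hCC) hd)]
        omega
    -- The branches of `A` lie in different branches of `R`: otherwise `A` would be contained in one
    -- of these, and `R` would not be the smallest vertex containing it.
    rcases hside B hBv (hU' ▸ Finset.subset_union_left) with hBD | hBE <;>
      rcases hside C hCv (hU' ▸ Finset.subset_union_right) with hCD | hCE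
    · exact absurd (hU' ▸ Finset.union_subset hBD hCD)
        (hnotsub D (mem_roots.1 hD).1 (hU ▸ Finset.subset_union_left))
    · exact main D E hD hE hDE hU hBD hCE
    · exact main E D hE hD hDE.symm (by rw [Finset.union_comm, hU]) hBE hCD
    · exact absurd (hU' ▸ Finset.union_subset hBE hCE)
        (hnotsub E (mem_roots.1 hE).1 (hU ▸ Finset.subset_union_right))

/-! ### The number of inner vertices as a rank function -/

theorem card_inner_le (h : F ≤ G) : F.inner.card ≤ G.inner.card := by
  obtain ⟨f, hf⟩ := h
  exact Finset.card_le_card_of_injOn f hf.inner_mem fun A hA B hB e => hf.inner_inj A hA B hB e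

theorem card_inner_strictMono : StrictMono fun G : LForest I => G.inner.card := by
  intro F G h
  obtain ⟨H, h1, -, h3⟩ := exists_card_inner_add_one h
  have := card_inner_le h1
  simp only
  omega

/-- Intervals of the poset of forests are ranked by the number of inner vertices. -/
theorem posetCorank_eq [Fact (F ≤ G)] (a : Set.Icc F G) :
    posetCorank a = G.inner.card - a.1.inner.card := by
  refine posetCorank_eq_of_strictMono (fun a : Set.Icc F G => a.1.inner.card)
    (fun a b h => card_inner_strictMono h) (fun a ha => ?_) a
  have hlt : F < a.1 := lt_of_le_of_ne a.2.1 fun e => ha (Subtype.ext e.symm)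
  obtain ⟨H, h1, h2, h3⟩ := exists_card_inner_add_one hlt
  refine ⟨⟨H, h1, h2.trans a.2.2⟩, lt_of_le_of_ne h2 fun e => ?_, h3⟩
  have e' : H = a.1 := congrArg Subtype.val e
  rw [e'] at h3
  omega

theorem intervalDeg_eq (h : F ≤ G) : intervalDeg h = G.inner.card - F.inner.card :=
  have : Fact (F ≤ G) := ⟨h⟩
  posetCorank_eq (⊥ : Set.Icc F G)

theorem intervalCharPoly_natDegree (h : F ≤ G) :
    (intervalCharPoly h).natDegree = intervalDeg h := by
  classical
  have : Fact (F ≤ G) := ⟨h⟩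
  let _ := Fintype.ofFinite (Set.Icc F G)
  refine charPoly_natDegree (P := Set.Icc F G) fun a ha => ?_
  have h1 := card_inner_strictMono (bot_lt_iff_ne_bot.2 ha : (⊥ : Set.Icc F G) < a)
  have h2 := card_inner_le a.2.2
  rw [posetDeg, posetCorank_eq, posetCorank_eq]
  simp only at h1
  omega

theorem intervalCharPoly_eval_zero (h : F ≤ G) :
    (intervalCharPoly h).eval 0 = intervalMoebius h := by
  classical
  have : Fact (F ≤ G) := ⟨h⟩
  let _ := Fintype.ofFinite (Set.Icc F G)
  refine charPoly_eval_zero (P := Set.Icc F G) fun a ha => ?_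
  by_contra hne
  have h1 := card_inner_strictMono (lt_top_iff_ne_top.2 hne : a < (⊤ : Set.Icc F G))
  rw [posetCorank_eq] at ha
  have h2 : a.1.inner.card < G.inner.card := h1
  omega

end LForest

/-! ### Special intervals -/

namespace LForest

variable {α : Type*} [DecidableEq α] {I I₁ I₂ : Finset α} {F G H T : LForest I}

theorem mem_restrict {J A : Finset α} {hJ : J ⊆ I} :
    A ∈ (G.restrict hJ).verts ↔ A ∈ G.verts ∧ A ⊆ J :=
  Finset.mem_filter

/-- A vertex `A ⊆ J` of `F` and its image in `G` have the same image in `T`, which lies in `J`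
because `J` is a vertex of `T`. So the image in `G` lies in `J` too, and smallest vertices may be
computed in the restriction. -/
theorem restrict_le {J : Finset α} (h : F ≤ G) (h' : G ≤ T) (hJ : J ∈ T.verts) (hJI : J ⊆ I) :
    F.restrict hJI ≤ G.restrict hJI := by
  have key : ∀ A ∈ F.verts, A ⊆ J → ∃ Z, G.IsLca A Z ∧ Z ⊆ J := by
    intro A hA hAJ
    obtain ⟨Z, hZ⟩ := exists_isLca_of_le h hA
    obtain ⟨W, hW⟩ := exists_isLca_of_le h' hZ.1
    exact ⟨Z, hZ, hW.2.1.trans ((hZ.trans h h' hA hW).2.2 J hJ hAJ)⟩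
  have key' : ∀ A ∈ (F.restrict hJI).inner, ∀ Z, (G.restrict hJI).IsLca A Z →
      A ∈ F.inner ∧ G.IsLca A Z := by
    intro A hA Z hZ
    obtain ⟨hA, hc⟩ := mem_inner.1 hA
    obtain ⟨hA, hAJ⟩ := mem_restrict.1 hA
    obtain ⟨Z', hZ', hZJ'⟩ := key A hA hAJ
    have e : Z = Z' := (hZ.2.2 Z' (mem_restrict.2 ⟨hZ'.1, hZJ'⟩) hZ'.2.1).antisymm
      (hZ'.2.2 Z (mem_restrict.1 hZ.1).1 hZ.2.1)
    exact ⟨mem_inner.2 ⟨hA, hc⟩, e ▸ hZ'⟩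
  refine le_iff.2 ⟨fun A hA => ?_, fun A hA B hB Z hAZ hBZ => ?_⟩
  · obtain ⟨hA, hAJ⟩ := mem_restrict.1 hA
    obtain ⟨Z, hZ, hZJ⟩ := key A hA hAJ
    exact ⟨Z, mem_restrict.2 ⟨hZ.1, hZJ⟩, hZ.2.1⟩
  · obtain ⟨hA, hAZ⟩ := key' A hA Z hAZ
    obtain ⟨hB, hBZ⟩ := key' B hB Z hBZ
    exact (le_iff.1 h).2 A hA B hB Z hAZ hBZ

theorem not_subset_of_disjoint {α : Type*} {A B C : Finset α} (hd : Disjoint B C) (hA : A.Nonempty)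
    (hB : A ⊆ B) : ¬ A ⊆ C := fun hC =>
  let ⟨_, hx⟩ := hA
  Finset.disjoint_left.1 hd (hB hx) (hC hx)

/-- The disjoint union of two forests. -/
def join (hd : Disjoint I₁ I₂) (hU : I₁ ∪ I₂ = I) (G₁ : LForest I₁) (G₂ : LForest I₂) :
    LForest I where
  verts := G₁.verts ∪ G₂.verts
  subset_labels A hA := by
    rw [← hU]
    rcases Finset.mem_union.1 hA with hA | hA
    · exact (G₁.subset_labels A hA).trans Finset.subset_union_left
    · exact (G₂.subset_labels A hA).trans Finset.subset_union_right
  nonempty A hA := (Finset.mem_union.1 hA).elim (G₁.nonempty A) (G₂.nonempty A)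
  leaf_mem i hi := by
    rw [← hU] at hi
    exact Finset.mem_union.2 ((Finset.mem_union.1 hi).imp (G₁.leaf_mem i) (G₂.leaf_mem i))
  laminar A hA B hB := by
    rcases Finset.mem_union.1 hA with hA | hA <;> rcases Finset.mem_union.1 hB with hB | hB
    · exact G₁.laminar A hA B hB
    · exact Or.inr (Or.inr (Finset.disjoint_of_subset_left (G₁.subset_labels A hA)
        (Finset.disjoint_of_subset_right (G₂.subset_labels B hB) hd)))
    · exact Or.inr (Or.inr (Finset.disjoint_of_subset_left (G₂.subset_labels A hA)
        (Finset.disjoint_of_subset_right (G₁.subset_labels B hB) hd.symm)))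
    · exact G₂.laminar A hA B hB
  binary A hA hc := by
    rcases Finset.mem_union.1 hA with hA | hA
    · obtain ⟨B, hB, C, hC, h⟩ := G₁.binary A hA hc
      exact ⟨B, Finset.mem_union_left _ hB, C, Finset.mem_union_left _ hC, h⟩
    · obtain ⟨B, hB, C, hC, h⟩ := G₂.binary A hA hc
      exact ⟨B, Finset.mem_union_right _ hB, C, Finset.mem_union_right _ hC, h⟩

/-! ### Disjoint unions of two forests and grafts over them -/

section join

variable {hd : Disjoint I₁ I₂} {hU : I₁ ∪ I₂ = I} {G₁ H₁ : LForest I₁} {G₂ H₂ : LForest I₂}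

theorem mem_join {A : Finset α} : A ∈ (join hd hU G₁ G₂).verts ↔ A ∈ G₁.verts ∨ A ∈ G₂.verts :=
  Finset.mem_union

theorem join_swap : join hd hU G₁ G₂ = join hd.symm (by rw [Finset.union_comm, hU]) G₂ G₁ :=
  LForest.ext (Finset.union_comm _ _)

theorem mem_left_of_mem_join {A : Finset α} (hA : A ∈ (join hd hU G₁ G₂).verts) {x : α}
    (hxA : x ∈ A) (hx : x ∈ I₁) : A ∈ G₁.verts :=
  (mem_join.1 hA).resolve_right fun h => Finset.disjoint_left.1 hd hx (G₂.subset_labels A h hxA)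

theorem mem_right_of_mem_join {A : Finset α} (hA : A ∈ (join hd hU G₁ G₂).verts) {x : α}
    (hxA : x ∈ A) (hx : x ∈ I₂) : A ∈ G₂.verts :=
  (mem_join.1 hA).resolve_left fun h => Finset.disjoint_right.1 hd hx (G₁.subset_labels A h hxA)

theorem isLca_left_of_join {A Z : Finset α} (hA : A.Nonempty) (hAI : A ⊆ I₁)
    (h : (join hd hU G₁ G₂).IsLca A Z) : G₁.IsLca A Z := by
  obtain ⟨x, hx⟩ := hA
  exact ⟨mem_left_of_mem_join h.1 (h.2.1 hx) (hAI hx), h.2.1,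
    fun W hW => h.2.2 W (mem_join.2 (Or.inl hW))⟩

theorem isLca_right_of_join {A Z : Finset α} (hA : A.Nonempty) (hAI : A ⊆ I₂)
    (h : (join hd hU G₁ G₂).IsLca A Z) : G₂.IsLca A Z := by
  obtain ⟨x, hx⟩ := hA
  exact ⟨mem_right_of_mem_join h.1 (h.2.1 hx) (hAI hx), h.2.1,
    fun W hW => h.2.2 W (mem_join.2 (Or.inr hW))⟩

theorem join_mono (h₁ : G₁ ≤ H₁) (h₂ : G₂ ≤ H₂) : join hd hU G₁ G₂ ≤ join hd hU H₁ H₂ := by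
  have key : ∀ A ∈ (join hd hU G₁ G₂).inner, ∀ Z, (join hd hU H₁ H₂).IsLca A Z →
      A ∈ G₁.inner ∧ H₁.IsLca A Z ∨ A ∈ G₂.inner ∧ H₂.IsLca A Z := by
    intro A hA Z hZ
    obtain ⟨hA, hc⟩ := mem_inner.1 hA
    rcases mem_join.1 hA with hA | hA
    · exact Or.inl ⟨mem_inner.2 ⟨hA, hc⟩,
        isLca_left_of_join (G₁.nonempty A hA) (G₁.subset_labels A hA) hZ⟩
    · exact Or.inr ⟨mem_inner.2 ⟨hA, hc⟩,
        isLca_right_of_join (G₂.nonempty A hA) (G₂.subset_labels A hA) hZ⟩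
  have hno : ∀ Z, Z ∈ H₁.verts → Z ∉ H₂.verts := fun Z h h' =>
    not_subset_of_disjoint hd (H₁.nonempty Z h) (H₁.subset_labels Z h) (H₂.subset_labels Z h')
  refine le_iff.2 ⟨fun A hA => ?_, fun A hA B hB Z hAZ hBZ => ?_⟩
  · rcases mem_join.1 hA with hA | hA
    · obtain ⟨Z, hZ, h⟩ := (le_iff.1 h₁).1 A hA
      exact ⟨Z, mem_join.2 (Or.inl hZ), h⟩
    · obtain ⟨Z, hZ, h⟩ := (le_iff.1 h₂).1 A hA
      exact ⟨Z, mem_join.2 (Or.inr hZ), h⟩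
  · rcases key A hA Z hAZ with ⟨hA, hAZ⟩ | ⟨hA, hAZ⟩ <;>
      rcases key B hB Z hBZ with ⟨hB, hBZ⟩ | ⟨hB, hBZ⟩
    · exact (le_iff.1 h₁).2 A hA B hB Z hAZ hBZ
    · exact absurd hBZ.1 (hno Z hAZ.1)
    · exact absurd hAZ.1 (hno Z hBZ.1)
    · exact (le_iff.1 h₂).2 A hA B hB Z hAZ hBZ

theorem root_join_left {R : Finset α} (hR : R ∈ G₁.roots) : R ∈ (join hd hU G₁ G₂).roots := by
  obtain ⟨hR, hm⟩ := mem_roots.1 hR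
  obtain ⟨x, hx⟩ := G₁.nonempty R hR
  exact mem_roots.2 ⟨mem_join.2 (Or.inl hR), fun W hW h =>
    hm W (mem_left_of_mem_join hW (h hx) (G₁.subset_labels R hR hx)) h⟩

theorem root_join_right {R : Finset α} (hR : R ∈ G₂.roots) : R ∈ (join hd hU G₁ G₂).roots := by
  obtain ⟨hR, hm⟩ := mem_roots.1 hR
  obtain ⟨x, hx⟩ := G₂.nonempty R hR
  exact mem_roots.2 ⟨mem_join.2 (Or.inr hR), fun W hW h =>
    hm W (mem_right_of_mem_join hW (h hx) (G₂.subset_labels R hR hx)) h⟩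

theorem card_inner_join : (join hd hU G₁ G₂).inner.card = G₁.inner.card + G₂.inner.card := by
  rw [inner, join, Finset.filter_union, Finset.card_union_of_disjoint]
  · rfl
  · refine Finset.disjoint_left.2 fun A hA hA' => ?_
    have h := (Finset.mem_filter.1 hA).1
    exact not_subset_of_disjoint hd (G₁.nonempty A h) (G₁.subset_labels A h)
      (G₂.subset_labels A (Finset.mem_filter.1 hA').1)

theorem restrict_eq_left (h : I₁ ⊆ I) (hG : ∀ A, A ⊆ I₁ →
    (A ∈ G.verts ↔ A ∈ (join hd hU G₁ G₂).verts)) : G.restrict h = G₁ := by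
  ext A
  rw [mem_restrict]
  constructor
  · rintro ⟨hA, hAI⟩
    obtain ⟨x, hx⟩ := G.nonempty A hA
    exact mem_left_of_mem_join ((hG A hAI).1 hA) hx (hAI hx)
  · intro hA
    exact ⟨(hG A (G₁.subset_labels A hA)).2 (mem_join.2 (Or.inl hA)), G₁.subset_labels A hA⟩

theorem restrict_eq_right (h : I₂ ⊆ I) (hG : ∀ A, A ⊆ I₂ →
    (A ∈ G.verts ↔ A ∈ (join hd hU G₁ G₂).verts)) : G.restrict h = G₂ := by
  rw [join_swap] at hG
  exact restrict_eq_left h hG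

theorem restrict_join_left (h : I₁ ⊆ I) : (join hd hU G₁ G₂).restrict h = G₁ :=
  restrict_eq_left h fun _ _ => Iff.rfl

theorem restrict_join_right (h : I₂ ⊆ I) : (join hd hU G₁ G₂).restrict h = G₂ :=
  restrict_eq_right h fun _ _ => Iff.rfl

theorem join_restrict_le (h₁ : I₁ ⊆ I) (h₂ : I₂ ⊆ I) :
    join hd hU (G.restrict h₁) (G.restrict h₂) ≤ G :=
  le_of_subset fun _ hA => (mem_join.1 hA).elim (fun h => (mem_restrict.1 h).1)
    fun h => (mem_restrict.1 h).1

theorem eq_join_restrict (h₁ : I₁ ⊆ I) (h₂ : I₂ ⊆ I) (h : ∀ A ∈ G.verts, A ⊆ I₁ ∨ A ⊆ I₂) :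
    G = join hd hU (G.restrict h₁) (G.restrict h₂) := by
  ext A
  rw [mem_join, mem_restrict, mem_restrict, ← and_or_left]
  exact ⟨fun hA => ⟨hA, h A hA⟩, And.left⟩

/-- `G` is obtained from the disjoint union of `G₁` and `G₂` by grafting on a new vertex the tree of
`G₁` containing `B` and the tree of `G₂` containing `C`. -/
def GraftOver (G : LForest I) (G₁ : LForest I₁) (G₂ : LForest I₂) (B C : Finset α) : Prop :=
  ∃ D ∈ G₁.roots, ∃ E ∈ G₂.roots, B ⊆ D ∧ C ⊆ E ∧ G.verts = insert (D ∪ E) (G₁.verts ∪ G₂.verts)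

theorem union_not_subset {D E : Finset α} (hd : Disjoint I₁ I₂) (hD : D ∈ G₁.verts)
    (hE : E ∈ G₂.verts) : ¬ D ∪ E ⊆ I₁ ∧ ¬ D ∪ E ⊆ I₂ :=
  ⟨fun h => not_subset_of_disjoint hd.symm (G₂.nonempty E hE) (G₂.subset_labels E hE)
      (Finset.subset_union_right.trans h),
    fun h => not_subset_of_disjoint hd (G₁.nonempty D hD) (G₁.subset_labels D hD)
      (Finset.subset_union_left.trans h)⟩

theorem disjoint_of_mem {D E : Finset α} (hd : Disjoint I₁ I₂) (hD : D ∈ G₁.verts)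
    (hE : E ∈ G₂.verts) : Disjoint D E :=
  Finset.disjoint_of_subset_left (G₁.subset_labels D hD)
    (Finset.disjoint_of_subset_right (G₂.subset_labels E hE) hd)

variable {B C : Finset α}

theorem exists_graftOver (hd : Disjoint I₁ I₂) (hU : I₁ ∪ I₂ = I)
    (hB : ∃ Z ∈ G₁.verts, B ⊆ Z) (hC : ∃ Z ∈ G₂.verts, C ⊆ Z) :
    ∃ G : LForest I, GraftOver G G₁ G₂ B C := by
  obtain ⟨Z, hZ, hBZ⟩ := hB
  obtain ⟨W, hW, hCW⟩ := hC
  obtain ⟨D, hD, hZD⟩ := exists_root hZ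
  obtain ⟨E, hE, hWE⟩ := exists_root hW
  have hne : D ≠ E := by
    rintro rfl
    have h1 := (mem_roots.1 hD).1
    exact not_subset_of_disjoint hd (G₁.nonempty D h1) (G₁.subset_labels D h1)
      (G₂.subset_labels D (mem_roots.1 hE).1)
  obtain ⟨G, hG⟩ := exists_graft (root_join_left (hd := hd) (hU := hU) (G₂ := G₂) hD)
    (root_join_right hE) hne
  exact ⟨G, D, hD, E, hE, hBZ.trans hZD, hCW.trans hWE, hG⟩

theorem GraftOver.mem_iff (hd : Disjoint I₁ I₂) (hU : I₁ ∪ I₂ = I) (h : GraftOver G G₁ G₂ B C)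
    {A : Finset α} (hA : A ⊆ I₁ ∨ A ⊆ I₂) : A ∈ G.verts ↔ A ∈ (join hd hU G₁ G₂).verts := by
  obtain ⟨D, hD, E, hE, -, -, hG⟩ := h
  rw [hG, Finset.mem_insert]
  refine or_iff_right ?_
  rintro rfl
  have := union_not_subset hd (mem_roots.1 hD).1 (mem_roots.1 hE).1
  exact hA.elim this.1 this.2

theorem GraftOver.restrict_left (hd : Disjoint I₁ I₂) (hU : I₁ ∪ I₂ = I)
    (h : GraftOver G G₁ G₂ B C) (hI : I₁ ⊆ I) : G.restrict hI = G₁ :=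
  restrict_eq_left hI fun _ hA => h.mem_iff hd hU (Or.inl hA)

theorem GraftOver.restrict_right (hd : Disjoint I₁ I₂) (hU : I₁ ∪ I₂ = I)
    (h : GraftOver G G₁ G₂ B C) (hI : I₂ ⊆ I) : G.restrict hI = G₂ :=
  restrict_eq_right hI fun _ hA => h.mem_iff hd hU (Or.inr hA)

/-- With `B` fixed, the root of `H₁` containing `B` contains the root of `G₁` containing `B`, and
likewise for `C`. Applied in both directions with equal sides, this also shows that `B` and `C`
determine the graft. -/
theorem GraftOver.le (hd : Disjoint I₁ I₂) (hU : I₁ ∪ I₂ = I) (hB : B.Nonempty) (hC : C.Nonempty)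
    (hG : GraftOver G G₁ G₂ B C) (hH : GraftOver H H₁ H₂ B C) (h₁ : G₁ ≤ H₁) (h₂ : G₂ ≤ H₂) :
    G ≤ H := by
  obtain ⟨D, hD, E, hE, hBD, hCE, hG⟩ := hG
  obtain ⟨D', hD', E', hE', hBD', hCE', hH⟩ := hH
  refine le_of_insert (join_mono (hd := hd) (hU := hU) h₁ h₂) hG hH (root_join_left hD')
    (disjoint_of_mem hd (mem_roots.1 hD').1 (mem_roots.1 hE').1) (hB.mono hBD) (hC.mono hCE) ?_ ?_
  · obtain ⟨x, hx⟩ := hB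
    exact subset_root_of_le h₁ (mem_roots.1 hD).1 hD' (hBD hx) (hBD' hx)
  · obtain ⟨x, hx⟩ := hC
    exact subset_root_of_le h₂ (mem_roots.1 hE).1 hE' (hCE hx) (hCE' hx)

theorem GraftOver.card_inner (hd : Disjoint I₁ I₂) (hU : I₁ ∪ I₂ = I)
    (h : GraftOver G G₁ G₂ B C) : G.inner.card = G₁.inner.card + G₂.inner.card + 1 := by
  obtain ⟨D, hD, E, hE, -, -, hG⟩ := h
  have hDv := (mem_roots.1 hD).1
  have hEv := (mem_roots.1 hE).1
  have hDE := disjoint_of_mem hd hDv hEv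
  rw [card_inner_of_insert (G' := join hd hU G₁ G₂) hG
    (union_notMem_verts (root_join_left hD) (G₂.nonempty E hEv) hDE)
    (one_lt_card_union (G₁.nonempty D hDv) (G₂.nonempty E hEv) hDE), card_inner_join]

theorem GraftOver.ne_join (h : GraftOver G G₁ G₂ B C) : join hd hU G₁ G₂ ≠ G := by
  obtain ⟨D, hD, E, hE, -, -, hG⟩ := h
  have hDE := disjoint_of_mem hd (mem_roots.1 hD).1 (mem_roots.1 hE).1
  rintro rfl
  refine union_notMem_verts (root_join_left (hd := hd) (hU := hU) (G₂ := G₂) hD)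
    (G₂.nonempty E (mem_roots.1 hE).1) hDE ?_
  rw [hG]
  exact Finset.mem_insert_self _ _

/-- If `B` and `C` are themselves roots, the new vertex is `B ∪ C`, whose parts on the two sides are
`B` and `C`. For smaller sets several pairs may give the same graft. -/
theorem GraftOver.root_inj (hd : Disjoint I₁ I₂) {B' C' : Finset α}
    (h : GraftOver G G₁ G₂ B C) (h' : GraftOver G G₁ G₂ B' C') (hB : B ∈ G₁.roots)
    (hC : C ∈ G₂.roots) (hB' : B' ∈ G₁.roots) (hC' : C' ∈ G₂.roots) : B = B' ∧ C = C' := by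
  obtain ⟨D, hD, E, hE, hBD, hCE, hG⟩ := h
  obtain ⟨D', hD', E', hE', hBD', hCE', hG'⟩ := h'
  have hDv := (mem_roots.1 hD).1
  have hEv := (mem_roots.1 hE).1
  rw [← (mem_roots.1 hB).2 D hDv hBD, ← (mem_roots.1 hC).2 E hEv hCE,
    ← (mem_roots.1 hB').2 D' (mem_roots.1 hD').1 hBD',
    ← (mem_roots.1 hC').2 E' (mem_roots.1 hE').1 hCE']
  have hns := union_not_subset hd hDv hEv
  have hmem : D ∪ E ∈ G.verts := hG ▸ Finset.mem_insert_self _ _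
  rw [hG'] at hmem
  have e : D ∪ E = D' ∪ E' := by
    rcases Finset.mem_insert.1 hmem with h | h
    · exact h
    · rcases Finset.mem_union.1 h with h | h
      · exact absurd (G₁.subset_labels _ h) hns.1
      · exact absurd (G₂.subset_labels _ h) hns.2
  constructor
  · obtain ⟨x, hx⟩ := G₁.nonempty D hDv
    refine root_unique hD hD' hx ?_
    have : x ∈ D' ∪ E' := e ▸ Finset.mem_union_left _ hx
    exact (Finset.mem_union.1 this).resolve_right fun h => Finset.disjoint_left.1 hd
      (G₁.subset_labels D hDv hx) (G₂.subset_labels E' (mem_roots.1 hE').1 h)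
  · obtain ⟨x, hx⟩ := G₂.nonempty E hEv
    refine root_unique hE hE' hx ?_
    have : x ∈ D' ∪ E' := e ▸ Finset.mem_union_right _ hx
    exact (Finset.mem_union.1 this).resolve_left fun h => Finset.disjoint_right.1 hd
      (G₂.subset_labels E hEv hx) (G₁.subset_labels D' (mem_roots.1 hD').1 h)

end join

/-! ### Forests below a tree, relative to its lowest vertex -/

section split

/-- A set of labels that is not on one side is sent to the lowest vertex. -/
theorem IsSplit.isLca (hI : T.IsSplit I₁ I₂) (hT : T.IsTree) {A : Finset α} (hA : A ⊆ I)
    (h₁ : ¬ A ⊆ I₁) (h₂ : ¬ A ⊆ I₂) : T.IsLca A I := by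
  refine ⟨hT, hA, fun W hW hAW => ?_⟩
  obtain ⟨hI₁, hI₂, -, hU⟩ := hI
  obtain ⟨x, hx, hx₁⟩ := Finset.not_subset.1 h₁
  obtain ⟨y, hy, hy₂⟩ := Finset.not_subset.1 h₂
  have hxI := hA hx
  have hyI := hA hy
  rw [← hU] at hxI hyI
  have hx₂ := (Finset.mem_union.1 hxI).resolve_left hx₁
  have hy₁ := (Finset.mem_union.1 hyI).resolve_right hy₂
  rw [← hU]
  refine Finset.union_subset ?_ ?_
  · exact (laminar_of_mem hW hI₁ (hAW hy) hy₁).resolve_left fun h => hx₁ (h (hAW hx))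
  · exact (laminar_of_mem hW hI₂ (hAW hx) hx₂).resolve_left fun h => hy₂ (h (hAW hy))

theorem IsSplit.one_lt_card (hI : T.IsSplit I₁ I₂) : 1 < I.card := by
  rw [← hI.2.2.2]
  exact one_lt_card_union (T.nonempty _ hI.1) (T.nonempty _ hI.2.1) hI.2.2.1

/-- Both vertices go to the lowest vertex of `T`, and the map is injective on inner vertices. -/
theorem IsSplit.crossing_unique (hI : T.IsSplit I₁ I₂) (hT : T.IsTree) (h : G ≤ T)
    {A B : Finset α} (hA : A ∈ G.verts) (hA₁ : ¬ A ⊆ I₁) (hA₂ : ¬ A ⊆ I₂) (hB : B ∈ G.verts)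
    (hB₁ : ¬ B ⊆ I₁) (hB₂ : ¬ B ⊆ I₂) : A = B := by
  have h1 := hI.isLca hT (G.subset_labels A hA) hA₁ hA₂
  have h2 := hI.isLca hT (G.subset_labels B hB) hB₁ hB₂
  exact (le_iff.1 h).2 A (inner_of_isLca hA h1 hI.one_lt_card) B
    (inner_of_isLca hB h2 hI.one_lt_card) I h1 h2

/-- A vertex inside `I₁` that contains `D` is comparable with `D ∪ E`. It cannot contain `E`, so it
lies in `D ∪ E` and hence in `D`. -/
theorem root_restrict_of_crossing {D E : Finset α} (hd : Disjoint I₁ I₂) (h₁ : I₁ ⊆ I)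
    (hDE : D ∪ E ∈ G.verts) (hD : D ∈ G.verts) (hDI : D ⊆ I₁) (hEI : E ⊆ I₂)
    (hE : E.Nonempty) : D ∈ (G.restrict h₁).roots := by
  refine mem_roots.2 ⟨mem_restrict.2 ⟨hD, hDI⟩, fun W hW hDW => ?_⟩
  obtain ⟨hW, hWI⟩ := mem_restrict.1 hW
  obtain ⟨x, hx⟩ := G.nonempty D hD
  rcases laminar_of_mem hW hDE (hDW hx) (Finset.mem_union_left _ hx) with h | h
  · refine Finset.Subset.antisymm (fun y hy => ?_) hDW
    exact (Finset.mem_union.1 (h hy)).resolve_right fun h' =>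
      Finset.disjoint_left.1 hd (hWI hy) (hEI h')
  · exact absurd (Finset.subset_union_right.trans (h.trans hWI))
      (not_subset_of_disjoint hd.symm hE hEI)

/-- By uniqueness the two branches of the crossing vertex do not cross, and they lie on opposite
sides since their union does cross. -/
theorem IsSplit.exists_of_crossing (hI : T.IsSplit I₁ I₂) (hT : T.IsTree) (h : G ≤ T)
    {A : Finset α} (hA : A ∈ G.verts) (hA₁ : ¬ A ⊆ I₁) (hA₂ : ¬ A ⊆ I₂) :
    ∃ D ∈ (G.restrict hI.left).roots, ∃ E ∈ (G.restrict hI.right).roots, D ∪ E = A ∧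
      G.verts = insert (D ∪ E) ((G.restrict hI.left).verts ∪ (G.restrict hI.right).verts) := by
  have hd := hI.2.2.1
  have hv : G.verts = insert A ((G.restrict hI.left).verts ∪ (G.restrict hI.right).verts) := by
    ext W
    rw [Finset.mem_insert, Finset.mem_union, mem_restrict, mem_restrict, ← and_or_left]
    constructor
    · intro hW
      by_cases hW' : W ⊆ I₁ ∨ W ⊆ I₂
      · exact Or.inr ⟨hW, hW'⟩
      · push Not at hW'
        exact Or.inl (hI.crossing_unique hT h hW hW'.1 hW'.2 hA hA₁ hA₂)
    · rintro (rfl | hW)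
      · exact hA
      · exact hW.1
  have hc := (mem_inner.1 (inner_of_isLca hA (hI.isLca hT (G.subset_labels A hA) hA₁ hA₂)
    hI.one_lt_card)).2
  obtain ⟨D, hD, E, hE, hDE, rfl⟩ := G.binary A hA hc
  have hside : ∀ X ∈ G.verts, X ≠ D ∪ E → X ⊆ I₁ ∨ X ⊆ I₂ := by
    intro X hX hne
    by_contra hno
    push Not at hno
    exact hne (hI.crossing_unique hT h hX hno.1 hno.2 hA hA₁ hA₂)
  have hDne := hside D hD fun e => not_subset_of_disjoint hDE.symm (G.nonempty E hE) subset_rfl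
    (Finset.union_eq_left.1 e.symm)
  have hEne := hside E hE fun e => not_subset_of_disjoint hDE (G.nonempty D hD) subset_rfl
    (Finset.union_eq_right.1 e.symm)
  rcases hDne with hD₁ | hD₂ <;> rcases hEne with hE₁ | hE₂
  · exact absurd (Finset.union_subset hD₁ hE₁) hA₁
  · exact ⟨D, root_restrict_of_crossing hd hI.left hA hD hD₁ hE₂ (G.nonempty E hE), E,
      root_restrict_of_crossing hd.symm hI.right (by rwa [Finset.union_comm]) hE hE₂ hD₁
        (G.nonempty D hD), rfl, hv⟩
  · refine ⟨E, root_restrict_of_crossing hd hI.left (by rwa [Finset.union_comm]) hE hE₁ hD₂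
      (G.nonempty D hD), D, root_restrict_of_crossing hd.symm hI.right hA hD hD₂ hE₁
        (G.nonempty E hE), Finset.union_comm _ _, ?_⟩
    rw [Finset.union_comm E D]
    exact hv
  · exact absurd (Finset.union_subset hD₂ hE₂) hA₂

theorem IsSplit.graftOver (hI : T.IsSplit I₁ I₂) (hT : T.IsTree) (h : G ≤ T) {A B C : Finset α}
    (hA : A ∈ G.verts) (hB : B.Nonempty) (hC : C.Nonempty) (hB₁ : B ⊆ I₁) (hC₂ : C ⊆ I₂)
    (hBA : B ⊆ A) (hCA : C ⊆ A) :
    GraftOver G (G.restrict hI.left) (G.restrict hI.right) B C := by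
  have hd := hI.2.2.1
  obtain ⟨D, hD, E, hE, rfl, hv⟩ := hI.exists_of_crossing hT h hA
    (fun h' => not_subset_of_disjoint hd.symm hC hC₂ (hCA.trans h'))
    (fun h' => not_subset_of_disjoint hd hB hB₁ (hBA.trans h'))
  refine ⟨D, hD, E, hE, fun x hx => ?_, fun x hx => ?_, hv⟩
  · exact (Finset.mem_union.1 (hBA hx)).resolve_right fun h' => Finset.disjoint_left.1 hd (hB₁ hx)
      ((mem_restrict.1 (mem_roots.1 hE).1).2 h')
  · exact (Finset.mem_union.1 (hCA hx)).resolve_left fun h' => Finset.disjoint_right.1 hd (hC₂ hx)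
      ((mem_restrict.1 (mem_roots.1 hD).1).2 h')

/-- A crossing vertex of `F` would have the lowest vertex of `T` as its image, which a special
interval excludes. -/
theorem IsSpecial.subset_or_subset (hs : IsSpecial F T) (hI : T.IsSplit I₁ I₂) :
    ∀ A ∈ F.verts, A ⊆ I₁ ∨ A ⊆ I₂ := by
  intro A hA
  by_contra hno
  push Not at hno
  obtain ⟨hT, -, f, hf, hne⟩ := hs
  have h := hI.isLca hT (F.subset_labels A hA) hno.1 hno.2
  exact hne A (inner_of_isLca hA h hI.one_lt_card) ((hf.isLca hA).unique h)

/-- Roots and inner vertices together number `I.card` in both forests, and a tree has a single root.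
-/
theorem card_roots_eq_of_le (h : F ≤ G) (hG : G.IsTree) :
    F.roots.card = intervalDeg h + 1 := by
  have h1 := card_roots_add_card_inner F
  have h2 := card_roots_add_card_inner G
  have h3 : G.roots = {I} := by
    ext R
    rw [mem_roots, Finset.mem_singleton]
    constructor
    · rintro ⟨hR, hm⟩
      exact (hm I hG (G.subset_labels R hR)).symm
    · rintro rfl
      exact ⟨hG, fun B hB h => (G.subset_labels B hB).antisymm h⟩
  have h4 := card_inner_le h
  rw [h3, Finset.card_singleton] at h2
  rw [intervalDeg_eq]
  omega

/-- The characteristic polynomial of a special interval. -/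
theorem IsSpecial.charPoly_eq (hs : IsSpecial F T) (hI : T.IsSplit I₁ I₂)
    (h₁ : F.restrict hI.left ≤ T.restrict hI.left)
    (h₂ : F.restrict hI.right ≤ T.restrict hI.right) :
    intervalCharPoly hs.le = (X - C (((intervalDeg h₁ : ℤ) + 1) * ((intervalDeg h₂ : ℤ) + 1))) *
      intervalCharPoly h₁ * intervalCharPoly h₂ := by
  classical
  have : Fact (F ≤ T) := ⟨hs.le⟩
  have : Fact (F.restrict hI.left ≤ T.restrict hI.left) := ⟨h₁⟩
  have : Fact (F.restrict hI.right ≤ T.restrict hI.right) := ⟨h₂⟩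
  have hT := hs.1
  have hd := hI.2.2.1
  have hU := hI.2.2.2
  have hFj : F = join hd hU (F.restrict hI.left) (F.restrict hI.right) :=
    eq_join_restrict _ _ (hs.subset_or_subset hI)
  let F₁ := F.restrict hI.left
  let F₂ := F.restrict hI.right
  let T₁ := T.restrict hI.left
  let T₂ := T.restrict hI.right
  let P := Set.Icc F T
  let P₁ := Set.Icc F₁ T₁
  let P₂ := Set.Icc F₂ T₂
  -- The grafts are indexed by roots of `F` itself, so that one index makes sense over every element
  -- of `P₁ × P₂`.
  let M := {B // B ∈ F₁.roots} × {B // B ∈ F₂.roots}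
  have hMv : ∀ m : M, m.1.1 ∈ F₁.verts ∧ m.2.1 ∈ F₂.verts := fun m =>
    ⟨(mem_roots.1 m.1.2).1, (mem_roots.1 m.2.2).1⟩
  have hMne : ∀ m : M, m.1.1.Nonempty ∧ m.2.1.Nonempty := fun m =>
    ⟨F₁.nonempty _ (hMv m).1, F₂.nonempty _ (hMv m).2⟩
  let p : P → P₁ × P₂ := fun x =>
    (⟨x.1.restrict hI.left, restrict_le x.2.1 x.2.2 hI.1 _, restrict_le x.2.2 le_rfl hI.1 _⟩,
      ⟨x.1.restrict hI.right, restrict_le x.2.1 x.2.2 hI.2.1 _,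
        restrict_le x.2.2 le_rfl hI.2.1 _⟩)
  have hpmono : Monotone p := fun x y h =>
    ⟨restrict_le h y.2.2 hI.1 hI.left, restrict_le h y.2.2 hI.2.1 hI.right⟩
  let s : P₁ × P₂ → P := fun q => ⟨join hd hU q.1.1 q.2.1,
    hFj.le.trans (join_mono q.1.2.1 q.2.2.1),
    (join_mono q.1.2.2 q.2.2.2).trans (join_restrict_le hI.left hI.right)⟩
  have hps : ∀ q, p (s q) = q := fun q => Prod.ext
    (Subtype.ext (restrict_join_left (hd := hd) (hU := hU) hI.left))
    (Subtype.ext (restrict_join_right (hd := hd) (hU := hU) hI.right))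
  -- The two sides of `T` are trees, so `T` is the graft for every pair of roots. This bounds all
  -- the `j m q` by `T`.
  have hTgraft : ∀ m : M, GraftOver T T₁ T₂ m.1.1 m.2.1 := by
    intro m
    exact hI.graftOver hT le_rfl hT (hMne m).1 (hMne m).2 (F₁.subset_labels _ (hMv m).1)
      (F₂.subset_labels _ (hMv m).2) ((F₁.subset_labels _ (hMv m).1).trans hI.left)
      ((F₂.subset_labels _ (hMv m).2).trans hI.right)
  have hex : ∀ (m : M) (q : P₁ × P₂), ∃ x : P, GraftOver x.1 q.1.1 q.2.1 m.1.1 m.2.1 := by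
    intro m q
    obtain ⟨G, hG⟩ := exists_graftOver hd hU ((le_iff.1 q.1.2.1).1 _ (hMv m).1)
      ((le_iff.1 q.2.2.1).1 _ (hMv m).2)
    refine ⟨⟨G, ?_, ?_⟩, hG⟩
    · refine (hFj.le.trans (join_mono q.1.2.1 q.2.2.1)).trans (le_of_subset ?_)
      obtain ⟨D, -, E, -, -, -, hv⟩ := hG
      rw [hv]
      exact Finset.subset_insert _ _
    · exact hG.le hd hU (hMne m).1 (hMne m).2 (hTgraft m) q.1.2.2 q.2.2.2
  choose j hj using hex
  have hpj : ∀ m q, p (j m q) = q := fun m q => Prod.ext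
    (Subtype.ext ((hj m q).restrict_left hd hU hI.left))
    (Subtype.ext ((hj m q).restrict_right hd hU hI.right))
  have huniq : ∀ m (x : P), GraftOver x.1 (p x).1.1 (p x).2.1 m.1.1 m.2.1 → x = j m (p x) := by
    intro m x hx
    refine le_antisymm ?_ ?_
    · exact hx.le hd hU (hMne m).1 (hMne m).2 (hj m (p x)) le_rfl le_rfl
    · exact (hj m (p x)).le hd hU (hMne m).1 (hMne m).2 hx le_rfl le_rfl
  have hcardT : ∀ m : M, T.inner.card = T₁.inner.card + T₂.inner.card + 1 := fun m =>
    (hTgraft m).card_inner hd hU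
  -- Some `m` is needed to apply `hcardT` when computing the coranks on the image of `s`, where no
  -- graft is given.
  have hM : Nonempty M := by
    obtain ⟨x, hx⟩ := T.nonempty _ hI.1
    obtain ⟨y, hy⟩ := T.nonempty _ hI.2.1
    obtain ⟨B, hB, -⟩ := exists_root (F₁.leaf_mem x hx)
    obtain ⟨C, hC, -⟩ := exists_root (F₂.leaf_mem y hy)
    exact ⟨⟨B, hB⟩, ⟨C, hC⟩⟩
  have hcard : (Fintype.card M : ℤ) = ((intervalDeg h₁ : ℤ) + 1) * ((intervalDeg h₂ : ℤ) + 1) := by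
    rw [Fintype.card_prod, Fintype.card_coe, Fintype.card_coe,
      card_roots_eq_of_le h₁ (mem_restrict.2 ⟨hI.1, subset_rfl⟩),
      card_roots_eq_of_le h₂ (mem_restrict.2 ⟨hI.2.1, subset_rfl⟩)]
    push_cast
    rfl
  rw [← hcard]
  refine charPoly_eq_of_cover (P := P) (P₁ := P₁) (P₂ := P₂) p s j hps hpj ?_ ?_ ?_ ?_ ?_ ?_ ?_
  · intro q x
    constructor
    · intro h
      have := hpmono h
      rwa [hps] at this
    · intro h
      have h1 : q.1.1 ≤ x.1.restrict hI.left := h.1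
      have h2 : q.2.1 ≤ x.1.restrict hI.right := h.2
      exact (join_mono (hd := hd) (hU := hU) h1 h2).trans (join_restrict_le hI.left hI.right)
  · intro m q x
    constructor
    · intro h
      refine ⟨by simpa only [hpj] using hpmono h, huniq m x ?_⟩
      -- The image in `x` of the grafting vertex `D ∪ E` contains `B` and `C`, so it crosses and `x`
      -- is a graft for the same pair.
      obtain ⟨D, -, E, -, hBD, hCE, hv⟩ := hj m q
      obtain ⟨Z, hZ, hDZ⟩ := (le_iff.1 (h : (j m q).1 ≤ x.1)).1 (D ∪ E)
        (hv ▸ Finset.mem_insert_self _ _)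
      exact hI.graftOver hT x.2.2 hZ (hMne m).1 (hMne m).2 (F₁.subset_labels _ (hMv m).1)
        (F₂.subset_labels _ (hMv m).2) ((hBD.trans Finset.subset_union_left).trans hDZ)
        ((hCE.trans Finset.subset_union_right).trans hDZ)
    · rintro ⟨h, e⟩
      rw [e]
      exact (hj m q).le hd hU (hMne m).1 (hMne m).2 (hj m (p x)) h.1 h.2
  · intro x
    by_cases hx : ∀ A ∈ x.1.verts, A ⊆ I₁ ∨ A ⊆ I₂
    · exact Or.inl (Subtype.ext (eq_join_restrict (hd := hd) (hU := hU) hI.left hI.right hx))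
    · right
      push Not at hx
      obtain ⟨A, hA, hA₁, hA₂⟩ := hx
      obtain ⟨D, hD, E, hE, -, hv⟩ := hI.exists_of_crossing hT x.2.2 hA hA₁ hA₂
      have hDv := (mem_roots.1 hD).1
      have hEv := (mem_roots.1 hE).1
      obtain ⟨a, ha⟩ := x.1.nonempty D (mem_restrict.1 hDv).1
      obtain ⟨b, hb⟩ := x.1.nonempty E (mem_restrict.1 hEv).1
      -- Any tree of `F₁` meeting `D` is contained in `D`, so picking a label on each branch yields
      -- a suitable pair of roots.
      obtain ⟨B, hB, haB⟩ := exists_root (F₁.leaf_mem a ((mem_restrict.1 hDv).2 ha))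
      obtain ⟨C, hC, hbC⟩ := exists_root (F₂.leaf_mem b ((mem_restrict.1 hEv).2 hb))
      refine ⟨(⟨B, hB⟩, ⟨C, hC⟩), huniq (⟨B, hB⟩, ⟨C, hC⟩) x ⟨D, hD, E, hE, ?_, ?_, hv⟩⟩
      · exact subset_root_of_le (p x).1.2.1 (mem_roots.1 hB).1 hD
          (Finset.singleton_subset_iff.1 haB) ha
      · exact subset_root_of_le (p x).2.2.1 (mem_roots.1 hC).1 hE
          (Finset.singleton_subset_iff.1 hbC) hb
  · intro m q h
    exact (hj m q).ne_join (hd := hd) (hU := hU) (congrArg Subtype.val h)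
  · intro m m' h
    have h1 := hj m ⊥
    have h2 := hj m' ⊥
    rw [h] at h1
    obtain ⟨e1, e2⟩ := h1.root_inj hd h2 m.1.2 m.2.2 m'.1.2 m'.2.2
    exact Prod.ext (Subtype.ext e1) (Subtype.ext e2)
  · intro q
    have h0 := hcardT hM.some
    have h3 := card_inner_le q.1.2.2
    have h4 := card_inner_le q.2.2.2
    have h5 : (s q).1.inner.card = _ := card_inner_join (hd := hd) (hU := hU)
    rw [posetCorank_eq, posetCorank_eq, posetCorank_eq, h5]
    omega
  · intro m q
    have h0 := hcardT m
    have h3 := card_inner_le q.1.2.2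
    have h4 := card_inner_le q.2.2.2
    have h5 := (hj m q).card_inner hd hU
    rw [posetCorank_eq, posetCorank_eq, posetCorank_eq, h5]
    omega

end split

end LForest

/-! ### The formulas for special intervals -/

theorem mainTheorem3 :
    ∃ Φ : ℤ[X] → ℤ[X] → ℤ[X],
      ∀ (α : Type*) [DecidableEq α] (I I₁ I₂ : Finset α) (F T : LForest I)
        (hs : LForest.IsSpecial F T) (hI : T.IsSplit I₁ I₂),
        ∃ (h₁ : F.restrict hI.left ≤ T.restrict hI.left)
          (h₂ : F.restrict hI.right ≤ T.restrict hI.right),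
          F.verts = (F.restrict hI.left).verts ∪ (F.restrict hI.right).verts ∧
          intervalCharPoly hs.le = Φ (intervalCharPoly h₁) (intervalCharPoly h₂) ∧
          intervalCharPoly hs.le =
            (X - C (((intervalDeg h₁ : ℤ) + 1) * ((intervalDeg h₂ : ℤ) + 1))) *
              intervalCharPoly h₁ * intervalCharPoly h₂ ∧
          intervalMoebius hs.le =
            -(((intervalDeg h₁ : ℤ) + 1) * ((intervalDeg h₂ : ℤ) + 1)) *
              intervalMoebius h₁ * intervalMoebius h₂ := by
  -- The degree of each interval is the degree of its characteristic polynomial, so the factor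
  -- depends on the two polynomials only.
  refine ⟨fun f g => (X - C (((f.natDegree : ℤ) + 1) * ((g.natDegree : ℤ) + 1))) * f * g, ?_⟩
  intro α _ I I₁ I₂ F T hs hI
  have h₁ := LForest.restrict_le hs.le le_rfl hI.1 hI.left
  have h₂ := LForest.restrict_le hs.le le_rfl hI.2.1 hI.right
  have h := hs.charPoly_eq hI h₁ h₂
  refine ⟨h₁, h₂, ?_, ?_, h, ?_⟩
  · exact congrArg LForest.verts (LForest.eq_join_restrict (hd := hI.2.2.1) (hU := hI.2.2.2)
      hI.left hI.right (hs.subset_or_subset hI))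
  · simp only [LForest.intervalCharPoly_natDegree]
    exact h
  -- The Möbius number is the value at `0`, where the linear factor becomes minus the product of the
  -- shifted degrees.
  · rw [← LForest.intervalCharPoly_eval_zero, h]
    simp only [eval_mul, eval_sub, eval_X, eval_C, zero_sub, LForest.intervalCharPoly_eval_zero]
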